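/- For a composition $\alpha=(\alpha_1,\dots,\alpha_s)$ with $\alpha_1,\alpha_s\ge 2$, let $\breve F(\alpha)$ be the fence poset on $\{x_1,\dots,x_n\}$, $n=\alpha_1+\cdots+\alpha_s-1$, whose cover relations are $$x_1\lhd x_2\lhd\cdots\lhd x_{m_1}\rhd x_{m_1+1}\rhd\cdots\rhd x_{m_2}\lhd x_{m_2+1}\lhd\cdots,\qquad m_k=\alpha_1+\cdots+\alpha_k \quad (1\le k<s).$$ Rowmotion on the antichains of a finite poset $P$ is the bijection $\rho$ that sends an antichain $A$ to the set of minimal elements of the complement of the lower order ideal generated by $A$. Rowmotion on ideals is the bijection $\hat\rho$ that sends a lower order ideal $I$ to the lower order ideal generated by the minimal elements of $P\setminus I$. Sending an antichain to the ideal it generates identifies the orbits of $\rho$ with those of $\hat\rho$. For an orbit $\mathcal O$ let $\#\mathcal O$ be its size, let $\chi(\mathcal O)=\sum_{A\in\mathcal O}\#A$ be the sum over the antichains of the orbit, and let $\hat\chi(\mathcal O)=\sum_{I\in\mathcal O}\#I$ be the sum over the corresponding ideals. A statistic is orbomesic if its sum over an orbit is the same for all orbits of the same size. **Theorem.** Let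 $a\ge 2$ be an integer. The orbits of rowmotion on $\breve F(a,a,a,a)$ can be partitioned into four sets $\mathcal S,\mathcal M,\mathcal L,\mathcal G$ with the following properties. (a) $\#\mathcal S=(a-1)^3$, $\#\mathcal M=a$, $\#\mathcal L=1$, $\#\mathcal G=a-1$, and $$\#\mathcal O=\begin{cases}a&\text{if }\mathcal O\in\mathcal S,\\ a+1&\text{if }\mathcal O\in\mathcal M,\\ a^2+a+1&\text{if }\mathcal O\in\mathcal L,\\ 3a^2+a&\text{if }\mathcal O\in\mathcal G.\end{cases}$$ (b) The statistics $\chi$ and $\hat\chi$ are orbomesic under rowmotion (on antichains and on ideals, respectively), with the following values: $$\begin{array}{c|cccc} &\mathcal S&\mathcal M&\mathcal L&\mathcal G\\ \hline \chi(\mathcal O)&4a-4&4a-2&4a^2-a&12a^2-11a+2\\ \hat\chi(\mathcal O)&2a^2-a&2a^2+3a-1&2a^3+3a-1&6a^3-a\end{array}$$ -/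

import Mathlib

namespace FenceRowmotion

/-! ### Fences -/

/-- The ground set `{x_1, …, x_n}`, `n = α_1 + ⋯ + α_s - 1`, of the fence of the composition `α`.
The element with (zero-based) index `i` is `x_{i+1}`. -/
def Fence (α : List ℕ) : Type := Fin (α.sum - 1)

instance (α : List ℕ) : Fintype (Fence α) := inferInstanceAs (Fintype (Fin (α.sum - 1)))

instance (α : List ℕ) : DecidableEq (Fence α) := inferInstanceAs (DecidableEq (Fin (α.sum - 1)))

/-- The zero-based index of an element of the fence. -/
def Fence.idx {α : List ℕ} (x : Fence α) : ℕ := Fin.val x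

theorem Fence.idx_injective {α : List ℕ} : Function.Injective (Fence.idx (α := α)) :=
  Fin.val_injective

/-- The step from index `i` to index `i + 1` goes up in the fence of `α`. The segments change at
the shared elements, which are the `x_m` with `m = α_1 + ⋯ + α_k`, `1 ≤ k < s`; the first segment
goes up and the directions alternate, so the step from `x_{i+1}` to `x_{i+2}` goes up if and only
if an even number of these `m` is at most `i + 1`. -/
def IsUp (α : List ℕ) (i : ℕ) : Prop :=
  Even ((Finset.Ico 1 α.length).filter fun k => (α.take k).sum ≤ i + 1).card

/-- The order of the fence: `x ⊴ y` if the path from `x` to `y` along the fence only goes up. -/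
instance (α : List ℕ) : PartialOrder (Fence α) where
  le x y := (x.idx ≤ y.idx ∧ ∀ i, x.idx ≤ i → i < y.idx → IsUp α i) ∨
    (y.idx ≤ x.idx ∧ ∀ i, y.idx ≤ i → i < x.idx → ¬ IsUp α i)
  le_refl x := Or.inl ⟨le_rfl, fun i h h' => absurd h' (not_lt.2 h)⟩
  le_trans x y z := by
    rintro (⟨h1, h2⟩ | ⟨h1, h2⟩) (⟨h3, h4⟩ | ⟨h3, h4⟩)
    · refine Or.inl ⟨h1.trans h3, fun i hi hi' => ?_⟩
      rcases lt_or_ge i y.idx with h | h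
      · exact h2 i hi h
      · exact h4 i h hi'
    · rcases h1.eq_or_lt with h | h
      · rw [h]; exact Or.inr ⟨h3, h4⟩
      rcases h3.eq_or_lt with h' | h'
      · rw [h']; exact Or.inl ⟨h1, h2⟩
      exact absurd (h2 (y.idx - 1) (by omega) (by omega)) (h4 (y.idx - 1) (by omega) (by omega))
    · rcases h1.eq_or_lt with h | h
      · rw [← h]; exact Or.inl ⟨h3, h4⟩
      rcases h3.eq_or_lt with h' | h'
      · rw [← h']; exact Or.inr ⟨h1, h2⟩
      exact absurd (h4 y.idx le_rfl h') (h2 y.idx le_rfl h)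
    · refine Or.inr ⟨h3.trans h1, fun i hi hi' => ?_⟩
      rcases lt_or_ge i y.idx with h | h
      · exact h4 i hi h
      · exact h2 i h hi'
  le_antisymm x y := by
    rintro (⟨h1, h2⟩ | ⟨h1, h2⟩) (⟨h3, h4⟩ | ⟨h3, h4⟩)
    · exact Fence.idx_injective (le_antisymm h1 h3)
    · rcases h1.eq_or_lt with h | h
      · exact Fence.idx_injective h
      · exact absurd (h2 x.idx le_rfl h) (h4 x.idx le_rfl h)
    · rcases h1.eq_or_lt with h | h
      · exact (Fence.idx_injective h).symm
      · exact absurd (h4 y.idx le_rfl h) (h2 y.idx le_rfl h)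
    · exact Fence.idx_injective (le_antisymm h3 h1)

/-! ### Rowmotion on a finite poset -/

section Poset

variable (P : Type*) [PartialOrder P]

/-- The antichains of `P`. -/
abbrev Antichains : Type _ := {A : Set P // IsAntichain (· ≤ ·) A}

/-- `c`: complementation, from lower order ideals to upper order ideals. -/
def compl : LowerSet P ≃ UpperSet P where
  toFun := LowerSet.compl
  invFun := UpperSet.compl
  left_inv := LowerSet.compl_compl
  right_inv := UpperSet.compl_compl

variable [Finite P]

noncomputable instance : Fintype (LowerSet P) :=
  have : Finite (LowerSet P) := Finite.of_injective (fun I => (I : Set P)) SetLike.coe_injective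
  Fintype.ofFinite _

noncomputable instance : Fintype (Antichains P) := Fintype.ofFinite _

/-- `Δ`: the maximal elements of a lower order ideal. Its inverse sends an antichain to the ideal
generated by it. -/
def maximals : LowerSet P ≃ Antichains P where
  toFun I := ⟨{x | Maximal (· ∈ I) x}, setOfPred_maximal_antichain _⟩
  invFun A := lowerClosure A.1
  left_inv I := by
    ext x
    simp only [SetLike.mem_coe, mem_lowerClosure, Set.mem_ofPred_eq]
    refine ⟨fun ⟨y, hy, hxy⟩ => I.lower hxy hy.prop, fun hx => ?_⟩
    obtain ⟨y, hxy, hy⟩ := (Set.toFinite (I : Set P)).exists_le_maximal hx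
    exact ⟨y, hy, hxy⟩
  right_inv A := by
    ext x
    simp only [Set.mem_ofPred_eq]
    constructor
    · intro hx
      obtain ⟨y, hy, hxy⟩ := mem_lowerClosure.1 hx.prop
      rwa [le_antisymm hxy (hx.2 (subset_lowerClosure hy) hxy)]
    · refine fun hx => ⟨subset_lowerClosure hx, fun y hy hxy => ?_⟩
      obtain ⟨z, hz, hyz⟩ := mem_lowerClosure.1 hy
      rwa [A.2.eq hx hz (hxy.trans hyz)]

/-- `∇`: the minimal elements of an upper order ideal. -/
def minimals : UpperSet P ≃ Antichains P where
  toFun U := ⟨{x | Minimal (· ∈ U) x}, setOfPred_minimal_antichain _⟩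
  invFun A := upperClosure A.1
  left_inv U := by
    ext x
    simp only [SetLike.mem_coe, mem_upperClosure, Set.mem_ofPred_eq]
    refine ⟨fun ⟨y, hy, hyx⟩ => U.upper hyx hy.prop, fun hx => ?_⟩
    obtain ⟨y, hyx, hy⟩ := (Set.toFinite (U : Set P)).exists_le_minimal hx
    exact ⟨y, hy, hyx⟩
  right_inv A := by
    ext x
    simp only [Set.mem_ofPred_eq]
    constructor
    · intro hx
      obtain ⟨y, hy, hyx⟩ := mem_upperClosure.1 hx.prop
      rwa [← le_antisymm hyx (hx.2 (subset_upperClosure hy) hyx)]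
    · refine fun hx => ⟨subset_upperClosure hx, fun y hy hyx => ?_⟩
      obtain ⟨z, hz, hzy⟩ := mem_upperClosure.1 hy
      rwa [← A.2.eq hz hx (hzy.trans hyx)]

/-- Rowmotion on antichains, `ρ = ∇ ∘ c ∘ Δ⁻¹`. -/
def rowmotion : Equiv.Perm (Antichains P) :=
  (maximals P).symm.trans ((compl P).trans (minimals P))

/-- Rowmotion on ideals, `ρ̂ = Δ⁻¹ ∘ ∇ ∘ c`. -/
def rowmotionIdeal : Equiv.Perm (LowerSet P) :=
  (compl P).trans ((minimals P).trans (maximals P).symm)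

end Poset

/-- `χ`: the number of elements of an antichain. -/
noncomputable def chi {P : Type*} [PartialOrder P] (A : Antichains P) : ℕ := A.1.ncard

/-- `χ̂`: the number of elements of an ideal. -/
noncomputable def chiHat {P : Type*} [PartialOrder P] (I : LowerSet P) : ℕ := (I : Set P).ncard

/-! ### Orbits and orbomesy -/

open Classical in
/-- The set of orbits of the group generated by the permutation `f` of a finite set. -/
noncomputable def orbits {X : Type*} [Fintype X] (f : Equiv.Perm X) : Finset (Finset X) :=
  Finset.univ.image fun x => Finset.univ.filter fun y => f.SameCycle x y

/-- The value `st O = ∑_{x ∈ O} st x` of a statistic on an orbit. -/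
def total {X : Type*} (st : X → ℕ) (O : Finset X) : ℕ := ∑ x ∈ O, st x

/-- The statistic `st` is orbomesic under the action of the group generated by `f`. -/
def IsOrbomesic {X : Type*} [Fintype X] (f : Equiv.Perm X) (st : X → ℕ) : Prop :=
  ∀ O₁ ∈ orbits f, ∀ O₂ ∈ orbits f, O₁.card = O₂.card → total st O₁ = total st O₂

/-- The set of ideals `Δ⁻¹(A)` generated by the antichains `A` in `O`. -/
def idealsOf {P : Type*} [PartialOrder P] [Finite P] (O : Finset (Antichains P)) :
    Finset (LowerSet P) :=
  O.map (maximals P).symm.toEmbedding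

end FenceRowmotion

open FenceRowmotion

/-!
The fence of `(a, a, a, a)` consists of four chains with `a - 1` elements each, joined by a left
peak, a valley and a right peak. An ideal meets every chain in an initial segment, whose length is
read as the position of a clock modulo `a`. Rowmotion on ideals lets each clock advance by one at
every step, except that two clocks which are simultaneously full at a peak (at the valley) add the
peak (remove the valley) and thereby wait for one step. `State` and `State.step` encode this
dynamics, and `State.rowmotionIdeal_toLowerSet` identifies it with rowmotion: the ideals of the
fence are the states (`State.toLowerSet_injective`, `State.toLowerSet_surjective`), and the maximal
elements after a step are the minimal elements of the complement before it.

The orbits are the fibres of an invariant, `State.label` (`State.sameCycle_iff_label`).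
* If neighbouring clocks are pairwise different, no clock ever waits. The three differences of
  neighbouring clocks are nonzero and invariant, which gives `(a - 1) ^ 3` orbits of size `a`.
* If the two clocks at each peak agree while those at the valley do not, each pair with its peak is
  a clock of period `a + 1`, and the two peaks never occur together. The phase difference of the two
  pairs is a nonzero residue modulo `a + 1`, which gives `a` orbits of size `a + 1`.
* In the remaining orbits the valley is absent at some time. Then only the outer clocks `x` and `z`
  are visible, and the dynamics returns to the same situation with `x + 1` and `z + 1`
  (`State.sameCycle_low_succ`), so that `z - x` modulo `a` is the only invariant. The difference `0`
  gives the orbit of the empty ideal, of size `a ^ 2 + a + 1`; on the other `a - 1` orbits, a pair of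
  clocks at a peak is locked for a while as the other pair runs through all phases relative to it,
  on either side, and the size is `3 * a ^ 2 + a`.

Apart from the full ideal, every fibre is a disjoint union of families in which all clocks run through `ZMod a` (through
`ZMod (a + 1)` for locked pairs) simultaneously, and the totals of the two statistics are sums over
these families (`State.sum_idealCard_mid`, `State.sum_antichainCard_mid`, `State.sum_fiber_G`).
Finally, rowmotion on antichains is conjugate to rowmotion on ideals, and the four orbit sizes are
distinct, so that the totals depend only on the size of the orbit.
-/

namespace FenceRowmotion

/-! ### States of four coupled clocks -/

/-- The lower order ideals of the fence of `(a, a, a, a)`, `1 < a`, encoded as states. The fence has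
a left peak, a valley and a right peak, which separate four chains of `a - 1` elements each. An
ideal meets each chain in an initial segment of the chain, counted from the bottom; its length is
recorded by `x`, `y`, `w`, `z`, from left to right, as a residue modulo `a` with representative in
`0, …, a - 1`. The constructors tell which of the peaks and the valley belong to the ideal:
* `low`: none of the three, so that the two inner chains are missed as well;
* `mid`: the valley only;
* `peakL`: the left peak and the valley, so that the two left chains are contained in the ideal;
* `peakR`: the right peak and the valley, so that the two right chains are contained in the ideal;
* `peaks`: all three, that is, the whole fence. -/
inductive State (a : ℕ) : Type
  | low (x z : ZMod a)
  | mid (x y w z : ZMod a)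
  | peakL (w z : ZMod a)
  | peakR (x y : ZMod a)
  | peaks

namespace State

variable {a : ℕ}

/-- Rowmotion on ideals in terms of states. Every chain is a clock that advances by `1` modulo `a`:
the next element is added, and a full chain is emptied. The exceptions are at the shared elements:
if the two clocks on the sides of a peak are both full, the peak is added and the clocks wait for
one step; if the two clocks at the valley are both full and no peak is added, the valley is removed
and the clocks wait for one step. If a peak is present, the two chains below it are full and are
emptied together, which restarts their clocks at `0`. -/
def step : State a → State a
  | low x z => mid (x + 1) 0 0 (z + 1)
  | mid x y w z =>
    if x = -1 ∧ y = -1 then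
      if w = -1 ∧ z = -1 then peaks else peakL (w + 1) (z + 1)
    else if w = -1 ∧ z = -1 then peakR (x + 1) (y + 1)
    else if y = -1 ∧ w = -1 then low (x + 1) (z + 1)
    else mid (x + 1) (y + 1) (w + 1) (z + 1)
  | peakL w z =>
    if w = -1 ∧ z = -1 then peakR 0 0
    else if w = -1 then low 0 (z + 1)
    else mid 0 0 (w + 1) (z + 1)
  | peakR x y =>
    if x = -1 ∧ y = -1 then peakL 0 0
    else if y = -1 then low (x + 1) 0
    else mid (x + 1) (y + 1) 0 0
  | peaks => low 0 0

/-- The values of the invariant `State.label`. The labels that occur are `S i j k` with `i`, `j`, `k`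
nonzero, `M d` with `d` nonzero, and all `G l`. -/
inductive Label (a : ℕ) : Type
  | S (i j k : ZMod a)
  | M (d : ZMod (a + 1))
  | G (l : ZMod a)
  deriving DecidableEq

/-- An invariant of the dynamics. A pair of clocks at a peak is locked if the two clocks agree, that
is, if the pair will pick up the peak. In `mid x y w z`:
* if no two neighbouring clocks agree, then no clock ever waits, and all differences are invariant;
* if both pairs are locked and the clocks at the valley differ, then each pair together with its
  peak is a clock of period `a + 1`, whose additional value `a` means that the peak is present; the
  difference of the two clocks modulo `a + 1` is invariant;
* if the clocks at the valley agree, the difference of the outer clocks modulo `a` is taken, and if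
  only one pair is locked, the difference of the two clocks of the other pair. -/
def label : State a → Label a
  | low x z => .G (z - x)
  | mid x y w z =>
    if y = w then .G (z - x)
    else if x = y then
      if w = z then .M (w.val - x.val) else .G (z - w)
    else if w = z then .G (y - x)
    else .S (x - y) (w - y) (z - w)
  | peakL w z => if w = z then .M (w.val - a) else .G (z - w)
  | peakR x y => if x = y then .M (a - x.val) else .G (y - x)
  | peaks => .G 0

/-! ### Invariance of the label -/

theorem val_add_one_of_ne [NeZero a] {x : ZMod a} (h : x ≠ -1) : (x + 1).val = x.val + 1 := by
  have h1 : x.val + 1 < a := by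
    refine lt_of_le_of_ne (ZMod.val_lt x) fun h2 => h ?_
    have := congrArg (Nat.cast : ℕ → ZMod a) h2
    simp only [Nat.cast_add, ZMod.natCast_val, ZMod.cast_id', id, Nat.cast_one, CharP.cast_eq_zero]
      at this
    exact eq_neg_of_add_eq_zero_left this
  have := ZMod.val_add_of_lt (a := x) (b := 1) ?_
  · rw [this, ZMod.val_one'' (by omega)]
  · rwa [ZMod.val_one'' (by omega)]

theorem val_neg_one_add [NeZero a] : (-1 : ZMod a).val + 1 = a := by
  obtain ⟨n, rfl⟩ := Nat.exists_eq_succ_of_ne_zero (NeZero.ne a)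
  rw [ZMod.val_neg_one]

theorem cast_val_add_one [NeZero a] {x : ZMod a} (h : x ≠ -1) :
    ((x + 1).val : ZMod (a + 1)) = x.val + 1 := by
  rw [val_add_one_of_ne h]; push_cast; rfl

theorem cast_val_neg_one [NeZero a] : ((-1 : ZMod a).val : ZMod (a + 1)) + 1 = a := by
  rw [← Nat.cast_add_one, val_neg_one_add]

theorem cast_self_add_one : (a : ZMod (a + 1)) + 1 = 0 := by
  exact_mod_cast ZMod.natCast_self (a + 1)

theorem label_step_mid [NeZero a] (x y w z : ZMod a) :
    (mid x y w z).step.label = (mid x y w z).label := by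
  have hx := cast_val_add_one (x := x)
  have hw := cast_val_add_one (x := w)
  have hn := cast_val_neg_one (a := a)
  simp only [step]
  split_ifs <;> simp only [label] <;> split_ifs <;>
    (try simp only [Label.G.injEq, Label.M.injEq, Label.S.injEq]) <;> grind

theorem label_step_peakL [Fact (1 < a)] [NeZero a] (w z : ZMod a) :
    (peakL w z).step.label = (peakL w z).label := by
  have h0 : (1 : ZMod a) ≠ 0 := one_ne_zero
  have hw := cast_val_add_one (x := w)
  have hn := cast_val_neg_one (a := a)
  have ha := cast_self_add_one (a := a)
  simp only [step]
  split_ifs <;> simp only [label, ZMod.val_zero] <;> split_ifs <;>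
    (try simp only [Label.G.injEq, Label.M.injEq]) <;> grind

theorem label_step_peakR [Fact (1 < a)] [NeZero a] (x y : ZMod a) :
    (peakR x y).step.label = (peakR x y).label := by
  have h0 : (1 : ZMod a) ≠ 0 := one_ne_zero
  have hw := cast_val_add_one (x := x)
  have hn := cast_val_neg_one (a := a)
  have ha := cast_self_add_one (a := a)
  simp only [step]
  split_ifs <;> simp only [label, ZMod.val_zero] <;> split_ifs <;>
    (try simp only [Label.G.injEq, Label.M.injEq]) <;> grind

/-- The label is an invariant of the dynamics. -/
theorem label_step [Fact (1 < a)] [NeZero a] (s : State a) : s.step.label = s.label := by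
  rcases s with ⟨x, z⟩ | ⟨x, y, w, z⟩ | ⟨w, z⟩ | ⟨x, y⟩ | _
  · simp [step, label]
  · exact label_step_mid x y w z
  · exact label_step_peakL w z
  · exact label_step_peakR x y
  · simp [step, label]

/-! ### States with the same label lie in the same cycle -/

/-- A family indexed by `ZMod N` lies in one cycle if neighbours do. The neighbours `-1` and `0` are
not needed, which matters below: the step of a state is regular except where a clock wraps around. -/
theorem sameCycle_of_chain {N : ℕ} [NeZero N] {X : Type*} (f : Equiv.Perm X) (g : ZMod N → X)
    (h : ∀ t, t ≠ -1 → f.SameCycle (g t) (g (t + 1))) (t t' : ZMod N) :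
    f.SameCycle (g t) (g t') := by
  have key : ∀ n : ℕ, n < N → f.SameCycle (g 0) (g n) := by
    intro n
    induction n with
    | zero => intro _; simpa using Equiv.Perm.SameCycle.refl f (g 0)
    | succ n ih =>
      intro hn
      have h1 : (n : ZMod N) ≠ -1 := by
        intro h2
        have h3 := val_neg_one_add (a := N)
        rw [← h2, ZMod.val_cast_of_lt (by omega)] at h3
        omega
      simpa using (ih (by omega)).trans (h _ h1)
  have key' (t : ZMod N) : f.SameCycle (g 0) (g t) := by
    simpa using key t.val (ZMod.val_lt t)
  exact (key' t).symm.trans (key' t')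

section Transitive

variable [NeZero a] {f : Equiv.Perm (State a)} (hf : ∀ s, f s = s.step)
include hf

omit [NeZero a] in
theorem sameCycle_step (s : State a) : f.SameCycle s s.step := by
  rw [← hf]; exact Equiv.Perm.sameCycle_apply_right.2 (Equiv.Perm.SameCycle.refl f s)

/-- No two neighbouring clocks agree if `i`, `j`, `k` are nonzero; only `k` is needed, as a state
with `i = 0` or `j = 0` picks up a peak or loses the valley only at the wrap-around `t = -1`. -/
theorem sameCycle_generic (i j : ZMod a) {k : ZMod a} (hk : k ≠ 0) (t t' : ZMod a) :
    f.SameCycle (mid (t + i) t (t + j) (t + j + k)) (mid (t' + i) t' (t' + j) (t' + j + k)) := by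
  refine sameCycle_of_chain f (fun t => mid (t + i) t (t + j) (t + j + k)) (fun t _ => ?_) t t'
  convert sameCycle_step hf _ using 1
  simp only [step]
  split_ifs <;> first | (congr 1 <;> ring1) | grind

theorem sameCycle_unlocked (k l t t' : ZMod a) :
    f.SameCycle (mid (t + k) t t (t + l)) (mid (t' + k) t' t' (t' + l)) := by
  refine sameCycle_of_chain f (fun t => mid (t + k) t t (t + l)) (fun t _ => ?_) t t'
  convert sameCycle_step hf _ using 1
  simp only [step]
  split_ifs <;> first | (congr 1 <;> ring1) | grind

theorem sameCycle_lockedL {l : ZMod a} (hl : l ≠ 0) (j t t' : ZMod a) :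
    f.SameCycle (mid t t (t + j) (t + j + l)) (mid t' t' (t' + j) (t' + j + l)) := by
  refine sameCycle_of_chain f (fun t => mid t t (t + j) (t + j + l)) (fun t _ => ?_) t t'
  convert sameCycle_step hf _ using 1
  simp only [step]
  split_ifs <;> first | (congr 1 <;> ring1) | grind

theorem sameCycle_lockedR {l : ZMod a} (hl : l ≠ 0) (j t t' : ZMod a) :
    f.SameCycle (mid (t + j + l) (t + j) t t) (mid (t' + j + l) (t' + j) t' t') := by
  refine sameCycle_of_chain f (fun t => mid (t + j + l) (t + j) t t) (fun t _ => ?_) t t'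
  convert sameCycle_step hf _ using 1
  simp only [step]
  split_ifs <;> first | (congr 1 <;> ring1) | grind

theorem sameCycle_mid_peakL {l : ZMod a} (hl : l ≠ 0) (t w : ZMod a) :
    f.SameCycle (mid t t w (w + l)) (peakL (w - t) (w - t + l)) := by
  have h := sameCycle_lockedL hf hl (w - t) t (-1)
  have h' := sameCycle_step hf (mid (-1) (-1) (-1 + (w - t)) (-1 + (w - t) + l))
  convert h.trans h' using 1
  · congr 1 <;> ring
  · simp only [step]
    split_ifs <;> first | (congr 1 <;> ring1) | grind

theorem sameCycle_mid_peakR {l : ZMod a} (hl : l ≠ 0) (t y : ZMod a) :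
    f.SameCycle (mid (y + l) y t t) (peakR (y - t + l) (y - t)) := by
  have h := sameCycle_lockedR hf hl (y - t) t (-1)
  have h' := sameCycle_step hf (mid (-1 + (y - t) + l) (-1 + (y - t)) (-1) (-1))
  convert h.trans h' using 1
  · congr 1 <;> ring
  · simp only [step]
    split_ifs <;> first | (congr 1 <;> ring1) | grind

/-- Each time the left peak is added, the left pair loses one step against the right pair, so that
`w` takes all values in turn, until the third chain is full while the left peak is present. Then the
left peak and the valley are removed together. -/
theorem sameCycle_peakL_low {l : ZMod a} (hl : l ≠ 0) (w : ZMod a) :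
    f.SameCycle (peakL w (w + l)) (low 0 l) := by
  refine (sameCycle_of_chain f (fun w => peakL w (w + l)) (fun t ht => ?_) w (-1)).trans ?_
  · have h := sameCycle_mid_peakL hf hl 0 (t + 1)
    simp only [sub_zero] at h
    refine Equiv.Perm.SameCycle.trans ?_ h
    convert sameCycle_step hf _ using 1
    simp only [step]
    split_ifs <;> first | (congr 1; ring1) | grind
  · convert sameCycle_step hf _ using 1
    simp only [step]
    split_ifs <;> first | (congr 1; ring1) | grind

theorem sameCycle_peakR_low {l : ZMod a} (hl : l ≠ 0) (y : ZMod a) :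
    f.SameCycle (peakR (y + l) y) (low l 0) := by
  refine (sameCycle_of_chain f (fun y => peakR (y + l) y) (fun t ht => ?_) y (-1)).trans ?_
  · have h := sameCycle_mid_peakR hf hl 0 (t + 1)
    simp only [sub_zero] at h
    refine Equiv.Perm.SameCycle.trans ?_ h
    convert sameCycle_step hf _ using 1
    simp only [step]
    split_ifs <;> first | (congr 1; ring1) | grind
  · convert sameCycle_step hf _ using 1
    simp only [step]
    split_ifs <;> first | (congr 1; ring1) | grind

theorem sameCycle_low_mid (x z t : ZMod a) :
    f.SameCycle (low x z) (mid (t + (x + 1)) t t (t + (z + 1))) := by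
  have h := sameCycle_unlocked hf (x + 1) (z + 1) 0 t
  rw [zero_add, zero_add] at h
  exact (sameCycle_step hf (low x z)).trans h

/-- After `low x z` the two clocks at the valley start together at `0`. When they are full, the outer
clocks show `x` and `z` again. If neither of these is full, the valley is removed, and the outer
clocks advance to `x + 1` and `z + 1`. Otherwise one peak or both are picked up instead, and the
same state without the valley is reached later, by `sameCycle_peakL_low` or its mirror image. -/
theorem sameCycle_low_succ (x z : ZMod a) : f.SameCycle (low x z) (low (x + 1) (z + 1)) := by
  have h := (sameCycle_low_mid hf x z (-1)).trans (sameCycle_step hf _)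
  rw [neg_add_cancel_comm_assoc, neg_add_cancel_comm_assoc] at h
  by_cases hx : x = -1 <;> by_cases hz : z = -1
  · simpa [step, hx, hz] using h.trans (sameCycle_step hf _)
  · have hl : z + 1 ≠ 0 := by grind
    have h' := sameCycle_peakL_low hf hl 0
    rw [zero_add] at h'
    simp only [step, hx, hz, and_self, and_false, if_true, if_false, neg_add_cancel] at h ⊢
    exact h.trans h'
  · have hl : x + 1 ≠ 0 := by grind
    have h' := sameCycle_peakR_low hf hl 0
    rw [zero_add] at h'
    simp only [step, hx, hz, and_self, false_and, if_true, if_false, neg_add_cancel] at h ⊢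
    exact h.trans h'
  · simpa only [step, hx, hz, and_self, false_and, and_false, if_true, if_false] using h

theorem sameCycle_low (x z : ZMod a) : f.SameCycle (low x z) (low 0 (z - x)) := by
  have h := sameCycle_of_chain f (fun t => low t (t + (z - x)))
    (fun t _ => by simpa [add_right_comm] using sameCycle_low_succ hf t (t + (z - x))) x 0
  simpa using h

/-- All states with the label `G l` are in the cycle of `low 0 l`. -/
theorem sameCycle_of_label_eq_G {s : State a} {l : ZMod a} (h : s.label = .G l) :
    f.SameCycle s (low 0 l) := by
  rcases s with ⟨x, z⟩ | ⟨x, y, w, z⟩ | ⟨w, z⟩ | ⟨x, y⟩ | _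
  · simp only [label, Label.G.injEq] at h
    exact h ▸ sameCycle_low hf x z
  · simp only [label] at h
    split_ifs at h with h1 h2 h3 h4
    · simp only [Label.G.injEq] at h
      have h5 := (sameCycle_low_mid hf (x - y - 1) (z - y - 1) y).symm.trans (sameCycle_low hf _ _)
      convert h5 using 1
      · rw [← h1]
        congr 1 <;> ring1
      · rw [← h]
        congr 1; ring1
    · simp only [Label.G.injEq] at h
      have hl : l ≠ 0 := by grind
      have h5 := (sameCycle_mid_peakL hf hl x w).trans (sameCycle_peakL_low hf hl _)
      convert h5 using 1
      grind
    · simp only [Label.G.injEq] at h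
      have hl : -l ≠ 0 := by grind
      have h5 := ((sameCycle_mid_peakR hf hl w y).trans (sameCycle_peakR_low hf hl _)).trans
        (sameCycle_low hf _ _)
      convert h5 using 1 <;> grind
  · simp only [label] at h
    split_ifs at h with h1
    simp only [Label.G.injEq] at h
    have hl : l ≠ 0 := by grind
    convert sameCycle_peakL_low hf hl w using 1
    grind
  · simp only [label] at h
    split_ifs at h with h1
    simp only [Label.G.injEq] at h
    have hl : -l ≠ 0 := by grind
    convert (sameCycle_peakR_low hf hl y).trans (sameCycle_low hf _ _) using 1 <;> grind
  · simp only [label, Label.G.injEq] at h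
    exact h ▸ sameCycle_step hf peaks

end Transitive

/-- The state in which the left pair of clocks and the right pair of clocks are locked, with phases
`s` and `t` modulo `a + 1`. The phase `a` means that the peak is present. For `s ≠ t` the two peaks
are never present together; for `s = t` the value is of no significance. -/
def locked (s t : ZMod (a + 1)) : State a :=
  if s.val = a then peakL t.val t.val
  else if t.val = a then peakR s.val s.val
  else mid s.val s.val t.val t.val

theorem natCast_eq_neg_one_iff [NeZero a] {n : ℕ} (hn : n < a) :
    (n : ZMod a) = -1 ↔ n + 1 = a := by
  constructor
  · intro h
    have h3 := val_neg_one_add (a := a)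
    rwa [← h, ZMod.val_cast_of_lt hn] at h3
  · intro h
    rw [eq_neg_iff_add_eq_zero]
    have : ((n + 1 : ℕ) : ZMod a) = 0 := by rw [h]; simp
    exact_mod_cast this

theorem val_add_one_eq (s : ZMod (a + 1)) : (s + 1).val = if s.val = a then 0 else s.val + 1 := by
  split_ifs with h
  · have : s = -1 := by
      apply ZMod.val_injective
      rw [h, ZMod.val_neg_one]
    simp [this]
  · apply val_add_one_of_ne
    rintro rfl
    exact h (ZMod.val_neg_one a)

/-- With distinct phases, two locked pairs are independent clocks of period `a + 1`. -/
theorem locked_step [Fact (1 < a)] [NeZero a] {s t : ZMod (a + 1)} (h : s ≠ t) :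
    (locked s t).step = locked (s + 1) (t + 1) := by
  have h1 : s.val ≠ t.val := fun h' => h (ZMod.val_injective _ h')
  have hs := ZMod.val_lt s
  have ht := ZMod.val_lt t
  have h2 : 1 < a := Fact.out
  have hs' : s.val < a → ((s.val : ZMod a) = -1 ↔ s.val + 1 = a) := natCast_eq_neg_one_iff
  have ht' : t.val < a → ((t.val : ZMod a) = -1 ↔ t.val + 1 = a) := natCast_eq_neg_one_iff
  simp only [locked, val_add_one_eq]
  generalize s.val = m at *
  generalize t.val = n at *
  have h0 : (0 : ZMod a) ≠ 1 := zero_ne_one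
  by_cases hm : m = a
  · subst hm
    simp only [if_true, step, and_self, ht' (by omega)]
    split_ifs <;> first | omega | simp
  by_cases hn : n = a
  · subst hn
    simp only [if_true, hm, if_false, step, and_self, hs' (by omega)]
    split_ifs <;> first | omega | simp
  simp only [hm, hn, if_false, step, and_self, hs' (by omega), ht' (by omega)]
  split_ifs <;> first | omega | simp

theorem eq_locked_of_label [NeZero a] {s : State a} {d : ZMod (a + 1)} (h : s.label = .M d) :
    ∃ t, locked t (t + d) = s := by
  have hc : ∀ x : ZMod a, ((x.val : ZMod (a + 1))).val = x.val := fun x =>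
    ZMod.val_cast_of_lt ((ZMod.val_lt x).trans (Nat.lt_succ_self a))
  have ha : (a : ZMod (a + 1)).val = a := ZMod.val_cast_of_lt (Nat.lt_succ_self a)
  have hx : ∀ x : ZMod a, x.val ≠ a := fun x => (ZMod.val_lt x).ne
  rcases s with ⟨x, z⟩ | ⟨x, y, w, z⟩ | ⟨w, z⟩ | ⟨x, y⟩ | _ <;> simp only [label] at h <;>
    (try split_ifs at h with h1 h2 h3) <;>
    simp only [Label.M.injEq, reduceCtorEq] at h
  · refine ⟨x.val, ?_⟩
    subst h2 h3
    simp [← h, locked, hc, hx, -ZMod.natCast_val, ZMod.natCast_zmod_val]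
  · refine ⟨a, ?_⟩
    subst h1
    simp [← h, locked, hc, ha, -ZMod.natCast_val, ZMod.natCast_zmod_val]
  · refine ⟨x.val, ?_⟩
    subst h1
    simp [← h, locked, hc, hx, ha, -ZMod.natCast_val, ZMod.natCast_zmod_val]

/-! ### Fibres of the label -/

theorem label_locked [NeZero a] {s t : ZMod (a + 1)} (h : s ≠ t) :
    (locked s t).label = .M (t - s) := by
  have h1 : s.val ≠ t.val := fun h' => h (ZMod.val_injective _ h')
  have hs := ZMod.val_lt s
  have ht := ZMod.val_lt t
  have hc : ∀ n : ℕ, n < a → (n : ZMod a).val = n := fun n => ZMod.val_cast_of_lt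
  have hi : ∀ m n : ℕ, m < a → n < a → (m : ZMod a) = n → m = n := fun m n hm hn he => by
    rw [← hc m hm, he, hc n hn]
  have hd : t - s = (t.val : ZMod (a + 1)) - s.val := by simp only [ZMod.natCast_zmod_val]
  rw [hd]
  simp only [locked]
  generalize s.val = m at *
  generalize t.val = n at *
  by_cases hm : m = a
  · subst hm
    simp [label, hc n (by omega), -ZMod.natCast_val]
  by_cases hn : n = a
  · subst hn
    simp [label, hm, hc m (by omega), -ZMod.natCast_val]
  have := hi m n (by omega) (by omega)
  simp only [hm, hn, if_false, label, if_true, hc m (by omega), hc n (by omega)]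
  rw [if_neg (fun h => h1 (this h))]

theorem locked_injective [NeZero a] (d : ZMod (a + 1)) :
    Function.Injective fun t : ZMod (a + 1) => locked t (t + d) := by
  intro s t h
  have hc : ∀ n : ℕ, n < a → (n : ZMod a).val = n := fun n => ZMod.val_cast_of_lt
  have hi : ∀ m n : ℕ, m < a → n < a → (m : ZMod a) = n → m = n := fun m n hm hn he => by
    rw [← hc m hm, he, hc n hn]
  have hs := ZMod.val_lt s
  have ht := ZMod.val_lt t
  have hs' := ZMod.val_lt (s + d)
  have ht' := ZMod.val_lt (t + d)
  have hv : s.val = t.val → s = t := fun h => ZMod.val_injective _ h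
  have hv' : (s + d).val = (t + d).val → s = t := fun h =>
    add_right_cancel (ZMod.val_injective _ h)
  simp only [locked] at h
  split_ifs at h with h1 h2 h3 h4 h5 h6
  · exact hv (by omega)
  · exact hv' (by omega)
  · exact hv (hi _ _ (by omega) (by omega) (mid.inj h).1)

theorem ne_zero_of_label_eq_M [NeZero a] {s : State a} {d : ZMod (a + 1)}
    (h : s.label = .M d) : d ≠ 0 := by
  have hi : ∀ m n : ℕ, m < a + 1 → n < a + 1 → m ≠ n → (m : ZMod (a + 1)) - n ≠ 0 := by
    intro m n hm hn hne he
    rw [← ZMod.val_cast_of_lt hm, ← ZMod.val_cast_of_lt hn, sub_eq_zero.1 he] at hne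
    exact hne rfl
  have hx : ∀ x : ZMod a, x.val < a := fun x => ZMod.val_lt x
  rcases s with ⟨x, z⟩ | ⟨x, y, w, z⟩ | ⟨w, z⟩ | ⟨x, y⟩ | _ <;> simp only [label] at h <;>
    (try split_ifs at h) <;> simp only [Label.M.injEq, reduceCtorEq] at h <;> subst h
  · have := hx x
    have := hx w
    refine hi _ _ (by omega) (by omega) fun he => ?_
    have := ZMod.val_injective _ he
    simp_all
  · have := hx w
    exact hi _ _ (by omega) (by omega) (by omega)
  · have := hx x
    exact hi _ _ (by omega) (by omega) (by omega)

theorem label_eq_S_iff {s : State a} {i j k : ZMod a} :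
    s.label = .S i j k ↔
      i ≠ 0 ∧ j ≠ 0 ∧ k ≠ 0 ∧ ∃ t, mid (t + i) t (t + j) (t + j + k) = s := by
  constructor
  · intro h
    rcases s with ⟨x, z⟩ | ⟨x, y, w, z⟩ | ⟨w, z⟩ | ⟨x, y⟩ | _ <;> simp only [label] at h <;>
      (try split_ifs at h) <;> simp only [Label.S.injEq, reduceCtorEq] at h
    obtain ⟨rfl, rfl, rfl⟩ := h
    refine ⟨by grind, by grind, by grind, y, ?_⟩
    congr 1 <;> ring1
  · rintro ⟨hi, hj, hk, t, rfl⟩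
    simp only [label]
    split_ifs
    all_goals first | (exfalso; grind) | (congr 1 <;> ring1)

theorem label_eq_M_iff [NeZero a] {s : State a} {d : ZMod (a + 1)} :
    s.label = .M d ↔ d ≠ 0 ∧ ∃ t, locked t (t + d) = s := by
  constructor
  · exact fun h => ⟨ne_zero_of_label_eq_M h, eq_locked_of_label h⟩
  · rintro ⟨hd, t, rfl⟩
    rw [label_locked (by simpa using hd), add_sub_cancel_left]

/-- The cycles of the step are the nonempty fibres of the label. -/
theorem sameCycle_iff_label [Fact (1 < a)] [NeZero a] {f : Equiv.Perm (State a)}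
    (hf : ∀ s, f s = s.step) (s s' : State a) : f.SameCycle s s' ↔ s.label = s'.label := by
  constructor
  · have hn : ∀ (n : ℕ) (s : State a), ((f ^ n) s).label = s.label := by
      intro n
      induction n with
      | zero => intro s; rfl
      | succ n ih => intro s; rw [pow_succ, Equiv.Perm.mul_apply, ih, hf, label_step]
    rintro ⟨i, rfl⟩
    obtain ⟨n, rfl | rfl⟩ := i.eq_nat_or_neg
    · rw [zpow_natCast, hn]
    · have h := hn n ((f ^ n)⁻¹ s)
      rwa [← Equiv.Perm.mul_apply, mul_inv_cancel, Equiv.Perm.one_apply, ← zpow_natCast,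
        ← zpow_neg] at h
  · intro h
    rcases hl : s'.label with ⟨i, j, k⟩ | d | l <;> rw [hl] at h
    · obtain ⟨-, -, hk, t, rfl⟩ := label_eq_S_iff.1 h
      obtain ⟨-, -, -, t', rfl⟩ := label_eq_S_iff.1 hl
      exact sameCycle_generic hf i j hk t t'
    · obtain ⟨hd, t, rfl⟩ := label_eq_M_iff.1 h
      obtain ⟨-, t', rfl⟩ := label_eq_M_iff.1 hl
      refine sameCycle_of_chain f (fun t => locked t (t + d)) (fun t _ => ?_) t t'
      rw [add_right_comm, ← locked_step (by simpa using hd)]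
      exact sameCycle_step hf _
    · exact (sameCycle_of_label_eq_G hf h).trans (sameCycle_of_label_eq_G hf hl).symm

theorem label_eq_G_zero_iff {s : State a} : s.label = .G 0 ↔
    (∃ x, low x x = s) ∨ (∃ k t, mid (t + k) t t (t + k) = s) ∨ peaks = s := by
  constructor
  · intro h
    rcases s with ⟨x, z⟩ | ⟨x, y, w, z⟩ | ⟨w, z⟩ | ⟨x, y⟩ | _ <;> simp only [label] at h <;>
      (try split_ifs at h) <;> (try simp only [Label.G.injEq] at h)
    · refine .inl ⟨x, ?_⟩
      congr 1; grind
    · refine .inr (.inl ⟨x - y, y, ?_⟩)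
      congr 1 <;> grind
    any_goals (exfalso; grind)
    exact .inr (.inr rfl)
  · rintro (⟨x, rfl⟩ | ⟨k, t, rfl⟩ | rfl) <;> simp [label]

/-- A parametrization of the fibre of `G l`, `l ≠ 0`, without repetitions: the states without the
valley, those with agreeing clocks at the valley, and those in which only the left pair or only the
right pair is locked, the peak being present or not. -/
theorem label_eq_G_iff {s : State a} {l : ZMod a} (hl : l ≠ 0) : s.label = .G l ↔
    (∃ x, low x (x + l) = s) ∨ (∃ k t, mid (t + k) t t (t + (k + l)) = s) ∨
    (∃ j ≠ 0, ∃ t, mid t t (t + j) (t + j + l) = s) ∨ (∃ w, peakL w (w + l) = s) ∨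
    (∃ j ≠ 0, ∃ t, mid (t + j - l) (t + j) t t = s) ∨ (∃ x, peakR x (x + l) = s) := by
  constructor
  · intro h
    rcases s with ⟨x, z⟩ | ⟨x, y, w, z⟩ | ⟨w, z⟩ | ⟨x, y⟩ | _ <;> simp only [label] at h <;>
      (try split_ifs at h) <;> simp only [Label.G.injEq] at h
    · refine .inl ⟨x, ?_⟩
      congr 1; grind
    · refine .inr (.inl ⟨x - y, y, ?_⟩)
      congr 1 <;> grind
    · refine .inr (.inr (.inl ⟨w - x, by grind, x, ?_⟩))
      congr 1 <;> grind
    · refine .inr (.inr (.inr (.inr (.inl ⟨y - w, by grind, w, ?_⟩))))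
      congr 1 <;> grind
    · refine .inr (.inr (.inr (.inl ⟨w, ?_⟩)))
      congr 1; grind
    · refine .inr (.inr (.inr (.inr (.inr ⟨x, ?_⟩))))
      congr 1; grind
    · exact absurd h.symm hl
  · rintro (⟨x, rfl⟩ | ⟨k, t, rfl⟩ | ⟨j, hj, t, rfl⟩ | ⟨w, rfl⟩ | ⟨j, hj, t, rfl⟩ | ⟨x, rfl⟩)
    · simp [label]
    · simp [label, add_sub_add_left_eq_sub]
    · simp [label, hl, hj]
    · simp [label, hl]
    · simp [label, hl, hj]
    · simp [label, hl]

instance [NeZero a] : Finite (State a) := by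
  let p : ((ZMod a × ZMod a) ⊕ (ZMod a × ZMod a × ZMod a × ZMod a)) ⊕
      ((ZMod a × ZMod a) ⊕ (ZMod a × ZMod a)) ⊕ Unit → State a :=
    Sum.elim (Sum.elim (fun v => low v.1 v.2) (fun v => mid v.1 v.2.1 v.2.2.1 v.2.2.2))
      (Sum.elim (Sum.elim (fun v => peakL v.1 v.2) (fun v => peakR v.1 v.2)) (fun _ => peaks))
  refine Finite.of_surjective p ?_
  rintro (⟨x, z⟩ | ⟨x, y, w, z⟩ | ⟨w, z⟩ | ⟨x, y⟩ | _)
  · exact ⟨.inl (.inl (x, z)), rfl⟩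
  · exact ⟨.inl (.inr (x, y, w, z)), rfl⟩
  · exact ⟨.inr (.inl (.inl (w, z))), rfl⟩
  · exact ⟨.inr (.inl (.inr (x, y))), rfl⟩
  · exact ⟨.inr (.inr ()), rfl⟩

noncomputable instance [NeZero a] : Fintype (State a) := Fintype.ofFinite _

/-- The states with a given label. -/
noncomputable def fiber [NeZero a] (l : Label a) : Finset (State a) :=
  Finset.univ.filter fun s => s.label = l

theorem mem_fiber [NeZero a] {l : Label a} {s : State a} : s ∈ fiber l ↔ s.label = l := by
  simp [fiber]

theorem sum_fiber [NeZero a] {T : Type*} [Fintype T] {l : Label a} (p : T → State a)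
    (hp : Function.Injective p) (h : ∀ s, s.label = l ↔ ∃ t, p t = s) (g : State a → ℤ) :
    ∑ s ∈ fiber l, g s = ∑ t, g (p t) := by
  have : fiber l = Finset.univ.map ⟨p, hp⟩ := by
    ext s; simp [mem_fiber, h]
  rw [this, Finset.sum_map]
  rfl

theorem sum_fiber_S [NeZero a] {i j k : ZMod a} (hi : i ≠ 0) (hj : j ≠ 0) (hk : k ≠ 0)
    (g : State a → ℤ) :
    ∑ s ∈ fiber (.S i j k), g s = ∑ t, g (mid (t + i) t (t + j) (t + j + k)) := by
  refine sum_fiber (fun t => mid (t + i) t (t + j) (t + j + k)) ?_ ?_ g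
  · intro t t' h
    exact (mid.inj h).2.1
  · simp [label_eq_S_iff, hi, hj, hk]

theorem sum_fiber_M [NeZero a] {d : ZMod (a + 1)} (hd : d ≠ 0) (g : State a → ℤ) :
    ∑ s ∈ fiber (.M d), g s = ∑ t, g (locked t (t + d)) := by
  refine sum_fiber (fun t => locked t (t + d)) (locked_injective d) ?_ g
  simp [label_eq_M_iff, hd]

theorem sum_fiber_G_zero [NeZero a] (g : State a → ℤ) :
    ∑ s ∈ fiber (.G 0), g s =
      ∑ x, g (low x x) + ∑ k, ∑ t, g (mid (t + k) t t (t + k)) + g peaks := by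
  rw [sum_fiber (Sum.elim (fun x : ZMod a => low x x) (Sum.elim
    (fun v : ZMod a × ZMod a => mid (v.2 + v.1) v.2 v.2 (v.2 + v.1)) (fun _ : Unit => peaks)))]
  · simp [Fintype.sum_prod_type, add_assoc]
  · rintro (x | ⟨k, t⟩ | _) (x' | ⟨k', t'⟩ | _) h <;> simp at h ⊢ <;> grind
  · simp [label_eq_G_zero_iff]

theorem sum_fiber_G [NeZero a] {l : ZMod a} (hl : l ≠ 0) (g : State a → ℤ) :
    ∑ s ∈ fiber (.G l), g s =
      ∑ x, g (low x (x + l)) + ∑ k, ∑ t, g (mid (t + k) t t (t + (k + l))) +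
      ∑ j : {j : ZMod a // j ≠ 0}, ∑ t, g (mid t t (t + j) (t + j + l)) +
      ∑ w, g (peakL w (w + l)) +
      ∑ j : {j : ZMod a // j ≠ 0}, ∑ t, g (mid (t + j - l) (t + j) t t) +
      ∑ x, g (peakR x (x + l)) := by
  rw [sum_fiber (Sum.elim (fun x : ZMod a => low x (x + l)) <| Sum.elim
    (fun v : ZMod a × ZMod a => mid (v.2 + v.1) v.2 v.2 (v.2 + (v.1 + l))) <| Sum.elim
    (fun v : {j : ZMod a // j ≠ 0} × ZMod a => mid v.2 v.2 (v.2 + v.1) (v.2 + v.1 + l)) <| Sum.elim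
    (fun w : ZMod a => peakL w (w + l)) <| Sum.elim
    (fun v : {j : ZMod a // j ≠ 0} × ZMod a => mid (v.2 + v.1 - l) (v.2 + v.1) v.2 v.2)
    (fun x : ZMod a => peakR x (x + l)))]
  · simp only [Fintype.sum_sum_type, Fintype.sum_prod_type, Sum.elim_inl, Sum.elim_inr, add_assoc]
  · rintro (x | ⟨k, t⟩ | ⟨⟨j, hj⟩, t⟩ | w | ⟨⟨j, hj⟩, t⟩ | x)
      (x' | ⟨k', t'⟩ | ⟨⟨j', hj'⟩, t'⟩ | w' | ⟨⟨j', hj'⟩, t'⟩ | x') h <;> simp at h ⊢ <;> grind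
  · simp [label_eq_G_iff hl]

/-! ### Sums of the statistics over the fibres -/

/-- The indicator of `x ≠ 0`: a nonempty initial segment of a chain has one maximal element. -/
def pos (x : ZMod a) : ℤ := if x = 0 then 0 else 1

/-- The number of maximal elements of the ideal encoded by a state. The chains below a peak of the
ideal do not contribute, and the valley is maximal only if the two chains above it are missed. -/
def antichainCard : State a → ℤ
  | low x z => pos x + pos z
  | mid x y w z => pos x + pos y + pos w + pos z + if y = 0 ∧ w = 0 then 1 else 0
  | peakL w z => pos w + pos z + 1
  | peakR x y => pos x + pos y + 1
  | peaks => 2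

/-- The number of elements of the ideal encoded by a state. -/
def idealCard : State a → ℤ
  | low x z => x.val + z.val
  | mid x y w z => x.val + y.val + w.val + z.val + 1
  | peakL w z => w.val + z.val + 2 * a
  | peakR x y => x.val + y.val + 2 * a
  | peaks => 4 * a - 1

theorem sum_comp_val (N : ℕ) [NeZero N] (F : ℕ → ℤ) :
    ∑ x : ZMod N, F x.val = ∑ i ∈ Finset.range N, F i := by
  obtain ⟨n, rfl⟩ := Nat.exists_eq_succ_of_ne_zero (NeZero.ne N)
  exact Fin.sum_univ_eq_sum_range F (n + 1)

theorem sum_val [NeZero a] : 2 * ∑ x : ZMod a, (x.val : ℤ) = a * (a - 1) := by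
  rw [sum_comp_val a (fun i => (i : ℤ))]
  have h : ∀ n : ℕ, 2 * ∑ i ∈ Finset.range n, (i : ℤ) = n * (n - 1) := by
    intro n
    induction n with
    | zero => simp
    | succ n ih => rw [Finset.sum_range_succ, mul_add, ih]; push_cast; ring
  exact h a

theorem sum_pos [NeZero a] : ∑ x : ZMod a, pos x = (a : ℤ) - 1 := by
  have h : ∀ x : ZMod a, pos x = 1 - if x = 0 then 1 else 0 := fun x => by
    unfold pos; split_ifs <;> rfl
  simp [h, ZMod.card]

theorem sum_add_right [NeZero a] (g : ZMod a → ℤ) (k : ZMod a) : ∑ t, g (t + k) = ∑ t, g t :=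
  Equiv.sum_comp (Equiv.addRight k) g

theorem card_ne_zero [NeZero a] : (Fintype.card {j : ZMod a // j ≠ 0} : ℤ) = a - 1 := by
  have h := Fintype.card_subtype_compl (fun j : ZMod a => j = 0)
  have ha := NeZero.pos a
  rw [Fintype.card_subtype_eq, ZMod.card] at h
  simp only [ne_eq, h]
  omega

theorem sum_idealCard_mid [NeZero a] (i j k l : ZMod a) :
    ∑ t, idealCard (mid (t + i) (t + j) (t + k) (t + l)) = 2 * (a : ℤ) ^ 2 - a := by
  simp only [idealCard, Finset.sum_add_distrib,
    sum_add_right (fun t : ZMod a => (t.val : ℤ)), Finset.sum_const, Finset.card_univ, ZMod.card,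
    nsmul_eq_mul]
  linear_combination 2 * sum_val (a := a)

/-- The valley is maximal at one time out of `a` if the clocks at the valley agree, and never
otherwise. -/
theorem sum_antichainCard_mid [NeZero a] (i j k l : ZMod a) :
    ∑ t, antichainCard (mid (t + i) (t + j) (t + k) (t + l)) =
      4 * (a : ℤ) - 4 + if j = k then 1 else 0 := by
  have h : ∑ t : ZMod a, (if t + j = 0 ∧ t + k = 0 then (1 : ℤ) else 0) =
      if j = k then 1 else 0 := by
    split_ifs with h
    · subst h
      rw [Finset.sum_eq_single (-j)] <;> simp +contextual [eq_neg_iff_add_eq_zero]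
    · refine Finset.sum_eq_zero fun t _ => if_neg ?_
      rintro ⟨h1, h2⟩
      exact h (add_left_cancel (h1.trans h2.symm))
  simp only [antichainCard, Finset.sum_add_distrib, sum_add_right pos, h, sum_pos]
  ring

theorem idealCard_locked [NeZero a] {s t : ZMod (a + 1)} (h : s ≠ t) :
    idealCard (locked s t) = (if s.val = a then 2 * (a : ℤ) - 1 else 2 * s.val) +
      (if t.val = a then 2 * (a : ℤ) - 1 else 2 * t.val) + 1 := by
  have h1 : s.val ≠ t.val := fun h' => h (ZMod.val_injective _ h')
  have hs := ZMod.val_lt s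
  have ht := ZMod.val_lt t
  have hc : ∀ n : ℕ, n < a → (n : ZMod a).val = n := fun n => ZMod.val_cast_of_lt
  simp only [locked]
  generalize s.val = m at *
  generalize t.val = n at *
  split_ifs <;> simp only [idealCard]
  · omega
  · rw [hc n (by omega)]; ring
  · rw [hc m (by omega)]; ring
  · rw [hc n (by omega), hc m (by omega)]; ring

theorem antichainCard_locked [NeZero a] {s t : ZMod (a + 1)} (h : s ≠ t) :
    antichainCard (locked s t) = (if s.val = a then 1 else if s.val = 0 then 0 else 2) +
      (if t.val = a then 1 else if t.val = 0 then 0 else 2) := by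
  have h1 : s.val ≠ t.val := fun h' => h (ZMod.val_injective _ h')
  have hs := ZMod.val_lt s
  have ht := ZMod.val_lt t
  have hc : ∀ n : ℕ, n < a → ((n : ZMod a) = 0 ↔ n = 0) := fun n hn => by
    rw [← ZMod.val_eq_zero, ZMod.val_cast_of_lt hn]
  simp only [locked]
  generalize s.val = m at *
  generalize t.val = n at *
  by_cases hm : m = a
  · have := hc n (by omega)
    simp only [hm, if_true, antichainCard, pos, this, show n ≠ a by omega, if_false]
    split_ifs <;> rfl
  by_cases hn : n = a
  · have := hc m (by omega)
    simp only [hm, hn, if_true, antichainCard, pos, this, if_false]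
    split_ifs <;> rfl
  have h2 := hc n (by omega)
  have h3 := hc m (by omega)
  simp only [hm, hn, antichainCard, pos, h2, h3, if_false]
  split_ifs <;> first | rfl | omega

section Totals

variable [NeZero a]

theorem sum_idealCard_S {i j k : ZMod a} (hi : i ≠ 0) (hj : j ≠ 0) (hk : k ≠ 0) :
    ∑ s ∈ fiber (.S i j k), idealCard s = 2 * (a : ℤ) ^ 2 - a := by
  rw [sum_fiber_S hi hj hk]
  simpa [add_assoc] using sum_idealCard_mid i 0 j (j + k)

theorem sum_antichainCard_S {i j k : ZMod a} (hi : i ≠ 0) (hj : j ≠ 0) (hk : k ≠ 0) :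
    ∑ s ∈ fiber (.S i j k), antichainCard s = 4 * (a : ℤ) - 4 := by
  rw [sum_fiber_S hi hj hk]
  simpa [add_assoc, hj.symm] using sum_antichainCard_mid i 0 j (j + k)

theorem card_fiber_S {i j k : ZMod a} (hi : i ≠ 0) (hj : j ≠ 0) (hk : k ≠ 0) :
    (fiber (.S i j k)).card = a := by
  have h := sum_fiber_S hi hj hk (fun _ => 1)
  simp only [Finset.sum_const, Finset.card_univ, ZMod.card, nsmul_eq_mul, mul_one] at h
  exact_mod_cast h

theorem sum_idealCard_M {d : ZMod (a + 1)} (hd : d ≠ 0) :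
    ∑ s ∈ fiber (.M d), idealCard s = 2 * (a : ℤ) ^ 2 + 3 * a - 1 := by
  have h1 : ∀ t : ZMod (a + 1), t ≠ t + d := fun t => by simpa using hd
  rw [sum_fiber_M hd]
  simp only [idealCard_locked (h1 _), Finset.sum_add_distrib]
  rw [sum_add_right (fun t : ZMod (a + 1) => if t.val = a then 2 * (a : ℤ) - 1 else 2 * t.val),
    sum_comp_val (a + 1) (fun n => if n = a then 2 * (a : ℤ) - 1 else 2 * n),
    Finset.sum_range_succ, Finset.sum_congr rfl (g := fun n : ℕ => 2 * (n : ℤ))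
      (fun n hn => if_neg (Finset.mem_range.1 hn).ne),
    ← sum_comp_val a (fun n => 2 * (n : ℤ)), ← Finset.mul_sum, sum_val]
  simp
  ring

theorem sum_antichainCard_M {d : ZMod (a + 1)} (hd : d ≠ 0) :
    ∑ s ∈ fiber (.M d), antichainCard s = 4 * (a : ℤ) - 2 := by
  have h1 : ∀ t : ZMod (a + 1), t ≠ t + d := fun t => by simpa using hd
  rw [sum_fiber_M hd]
  simp only [antichainCard_locked (h1 _), Finset.sum_add_distrib]
  rw [sum_add_right (fun t : ZMod (a + 1) => if t.val = a then 1 else if t.val = 0 then 0 else 2),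
    sum_comp_val (a + 1) (fun n => if n = a then 1 else if n = 0 then 0 else 2),
    Finset.sum_range_succ, Finset.sum_congr rfl (g := fun n : ℕ => if n = 0 then 0 else 2)
      (fun n hn => if_neg (Finset.mem_range.1 hn).ne),
    ← sum_comp_val a (fun n => if n = 0 then 0 else 2)]
  have h : ∑ x : ZMod a, (if x.val = 0 then 0 else 2) = 2 * ((a : ℤ) - 1) := by
    rw [← sum_pos, Finset.mul_sum]
    refine Finset.sum_congr rfl fun x _ => ?_
    simp only [ZMod.val_eq_zero, pos]
    split_ifs <;> rfl
  rw [h, if_pos rfl]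
  ring

theorem card_fiber_M {d : ZMod (a + 1)} (hd : d ≠ 0) : (fiber (.M d)).card = a + 1 := by
  have h := sum_fiber_M hd (fun _ => 1)
  simp only [Finset.sum_const, Finset.card_univ, ZMod.card, nsmul_eq_mul, mul_one] at h
  exact_mod_cast h

theorem sum_idealCard_G_zero :
    ∑ s ∈ fiber (.G (0 : ZMod a)), idealCard s = 2 * (a : ℤ) ^ 3 + 3 * a - 1 := by
  have h : ∀ k : ZMod a, ∑ t, idealCard (mid (t + k) t t (t + k)) = 2 * (a : ℤ) ^ 2 - a :=
    fun k => by simpa using sum_idealCard_mid k 0 0 k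
  rw [sum_fiber_G_zero]
  simp only [h, Finset.sum_const, Finset.card_univ, ZMod.card, nsmul_eq_mul]
  simp only [idealCard, Finset.sum_add_distrib]
  linear_combination sum_val (a := a)

theorem sum_antichainCard_G_zero :
    ∑ s ∈ fiber (.G (0 : ZMod a)), antichainCard s = 4 * (a : ℤ) ^ 2 - a := by
  have h : ∀ k : ZMod a, ∑ t, antichainCard (mid (t + k) t t (t + k)) = 4 * (a : ℤ) - 4 + 1 :=
    fun k => by simpa using sum_antichainCard_mid k 0 0 k
  rw [sum_fiber_G_zero]
  simp only [h, Finset.sum_const, Finset.card_univ, ZMod.card, nsmul_eq_mul]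
  simp only [antichainCard, Finset.sum_add_distrib, sum_pos]
  ring

theorem card_fiber_G_zero : (fiber (.G (0 : ZMod a))).card = a ^ 2 + a + 1 := by
  have h := sum_fiber_G_zero (a := a) (fun _ => 1)
  simp only [Finset.sum_const, Finset.card_univ, ZMod.card, nsmul_eq_mul, mul_one] at h
  zify
  rw [h]
  ring

theorem sum_idealCard_G {l : ZMod a} (hl : l ≠ 0) :
    ∑ s ∈ fiber (.G l), idealCard s = 6 * (a : ℤ) ^ 3 - a := by
  have h1 : ∀ k : ZMod a, ∑ t, idealCard (mid (t + k) t t (t + (k + l))) = 2 * (a : ℤ) ^ 2 - a :=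
    fun k => by simpa using sum_idealCard_mid k 0 0 (k + l)
  have h2 : ∀ j : ZMod a, ∑ t, idealCard (mid t t (t + j) (t + j + l)) = 2 * (a : ℤ) ^ 2 - a :=
    fun j => by simpa [add_assoc] using sum_idealCard_mid 0 0 j (j + l)
  have h3 : ∀ j : ZMod a, ∑ t, idealCard (mid (t + j - l) (t + j) t t) = 2 * (a : ℤ) ^ 2 - a :=
    fun j => by simpa [add_sub_assoc] using sum_idealCard_mid (j - l) j 0 0
  rw [sum_fiber_G hl]
  simp only [h1, h2, h3, Finset.sum_const, Finset.card_univ, ZMod.card, nsmul_eq_mul, card_ne_zero]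
  simp only [idealCard, Finset.sum_add_distrib, sum_add_right (fun t : ZMod a => (t.val : ℤ)),
    Finset.sum_const, Finset.card_univ, ZMod.card, nsmul_eq_mul]
  linear_combination 3 * sum_val (a := a)

theorem sum_antichainCard_G {l : ZMod a} (hl : l ≠ 0) :
    ∑ s ∈ fiber (.G l), antichainCard s = 12 * (a : ℤ) ^ 2 - 11 * a + 2 := by
  have h1 : ∀ k : ZMod a,
      ∑ t, antichainCard (mid (t + k) t t (t + (k + l))) = 4 * (a : ℤ) - 4 + 1 :=
    fun k => by simpa using sum_antichainCard_mid k 0 0 (k + l)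
  have h2 : ∀ j : {j : ZMod a // j ≠ 0},
      ∑ t, antichainCard (mid t t (t + (j : ZMod a)) (t + (j : ZMod a) + l)) = 4 * (a : ℤ) - 4 :=
    fun j => by simpa [add_assoc, j.2.symm] using sum_antichainCard_mid 0 0 j.1 (j.1 + l)
  have h3 : ∀ j : {j : ZMod a // j ≠ 0},
      ∑ t, antichainCard (mid (t + (j : ZMod a) - l) (t + (j : ZMod a)) t t) = 4 * (a : ℤ) - 4 :=
    fun j => by simpa [add_sub_assoc, j.2] using sum_antichainCard_mid (j.1 - l) j.1 0 0
  rw [sum_fiber_G hl]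
  simp only [h1, h2, h3, Finset.sum_const, Finset.card_univ, ZMod.card, nsmul_eq_mul, card_ne_zero]
  simp only [antichainCard, Finset.sum_add_distrib, sum_add_right pos, sum_pos,
    Finset.sum_const, Finset.card_univ, ZMod.card, nsmul_eq_mul]
  ring

theorem card_fiber_G {l : ZMod a} (hl : l ≠ 0) : (fiber (.G l)).card = 3 * a ^ 2 + a := by
  have h := sum_fiber_G hl (fun _ => 1)
  simp only [Finset.sum_const, Finset.card_univ, ZMod.card, nsmul_eq_mul, mul_one,
    card_ne_zero] at h
  zify
  rw [h]
  ring

end Totals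

end State

/-! ### Lower order ideals of fences -/

section Fence

variable {α : List ℕ}

theorem Fence.idx_lt (x : Fence α) : x.idx < α.sum - 1 := Fin.is_lt x

theorem Fence.exists_idx_eq {i : ℕ} (hi : i < α.sum - 1) : ∃ x : Fence α, x.idx = i :=
  ⟨(⟨i, hi⟩ : Fin (α.sum - 1)), rfl⟩

theorem Fence.le_iff {x y : Fence α} : x ≤ y ↔
    (x.idx ≤ y.idx ∧ ∀ i, x.idx ≤ i → i < y.idx → IsUp α i) ∨
    (y.idx ≤ x.idx ∧ ∀ i, y.idx ≤ i → i < x.idx → ¬ IsUp α i) := Iff.rfl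

/-- The predicate `p` on indices is inherited downwards along the cover relations of the fence. -/
def StepClosed (α : List ℕ) (p : ℕ → Prop) : Prop :=
  ∀ i, i + 1 < α.sum - 1 → (IsUp α i → p (i + 1) → p i) ∧ (¬ IsUp α i → p i → p (i + 1))

theorem StepClosed.of_le {p : ℕ → Prop} (hp : StepClosed α p) {x y : Fence α} (h : x ≤ y)
    (hy : p y.idx) : p x.idx := by
  rcases Fence.le_iff.1 h with ⟨hxy, h⟩ | ⟨hyx, h⟩
  · refine Nat.decreasingInduction' (P := p) (fun k hk hk' ih => ?_) hxy hy
    exact (hp k (by have := y.idx_lt; omega)).1 (h k hk' hk) ih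
  · refine Nat.le_induction (P := fun n _ => n ≤ x.idx → p n) (fun _ => hy)
      (fun k hk ih hk' => ?_) x.idx hyx le_rfl
    exact (hp k (by have := x.idx_lt; omega)).2 (h k hk (by omega)) (ih (by omega))

theorem stepClosed_of_lowerSet (I : LowerSet (Fence α)) :
    StepClosed α fun i => ∃ x ∈ I, x.idx = i := by
  intro i hi
  obtain ⟨x, rfl⟩ := Fence.exists_idx_eq (α := α) (i := i) (by omega)
  obtain ⟨y, hy⟩ := Fence.exists_idx_eq (α := α) hi
  constructor
  · rintro h ⟨y', hy', h'⟩
    obtain rfl := Fence.idx_injective (h'.trans hy.symm)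
    refine ⟨x, I.lower (Fence.le_iff.2 (.inl ⟨by omega, fun j h1 h2 => ?_⟩)) hy', rfl⟩
    rwa [show j = x.idx by omega]
  · rintro h ⟨x', hx', h'⟩
    obtain rfl := Fence.idx_injective h'
    refine ⟨y, I.lower (Fence.le_iff.2 (.inr ⟨by omega, fun j h1 h2 => ?_⟩)) hx', hy⟩
    rwa [show j = x'.idx by omega]

/-- The lower order ideal of the elements of the fence whose index satisfies `p`. -/
def lowerSetOf (p : ℕ → Prop) (hp : StepClosed α p) : LowerSet (Fence α) where
  carrier := {x | p x.idx}
  lower' _ _ h hy := hp.of_le h hy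

theorem mem_lowerSetOf {p : ℕ → Prop} {hp : StepClosed α p} {x : Fence α} :
    x ∈ lowerSetOf p hp ↔ p x.idx := Iff.rfl

theorem maximal_lowerSetOf_iff {p : ℕ → Prop} (hp : StepClosed α p) {x : Fence α} :
    Maximal (· ∈ lowerSetOf p hp) x ↔
      p x.idx ∧ (x.idx + 1 < α.sum - 1 → IsUp α x.idx → ¬ p (x.idx + 1)) ∧
        (∀ j, j + 1 = x.idx → ¬ IsUp α j → ¬ p j) := by
  have hx := x.idx_lt
  constructor
  · intro h
    refine ⟨h.1, fun h1 h2 h3 => ?_, fun j h1 h2 h3 => ?_⟩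
    · obtain ⟨y, hy⟩ := Fence.exists_idx_eq (α := α) h1
      have hxy : x ≤ y := Fence.le_iff.2 (.inl ⟨by omega, fun j _ _ => by
        rwa [show j = x.idx by omega]⟩)
      have := h.eq_of_le (y := y) (by rwa [mem_lowerSetOf, hy]) hxy
      subst this
      omega
    · obtain ⟨y, hy⟩ := Fence.exists_idx_eq (α := α) (i := j) (by omega)
      have hxy : x ≤ y := Fence.le_iff.2 (.inr ⟨by omega, fun i _ _ => by
        rwa [show i = j by omega]⟩)
      have := h.eq_of_le (y := y) (by rwa [mem_lowerSetOf, hy]) hxy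
      subst this
      omega
  · rintro ⟨h1, h2, h3⟩
    refine ⟨h1, fun y hy hxy => ?_⟩
    have hyl := y.idx_lt
    simp only [mem_lowerSetOf] at hy
    rcases Fence.le_iff.1 hxy with ⟨h4, h5⟩ | ⟨h4, h5⟩
    · rcases h4.eq_or_lt with h6 | h6
      · rw [Fence.idx_injective h6]
      · obtain ⟨z, hz⟩ := Fence.exists_idx_eq (α := α) (i := x.idx + 1) (by omega)
        have hzy : z ≤ y := Fence.le_iff.2 (.inl ⟨by omega, fun j _ _ => h5 j (by omega) (by omega)⟩)
        exact absurd (hz ▸ hp.of_le hzy hy) (h2 (by omega) (h5 _ le_rfl h6))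
    · rcases h4.eq_or_lt with h6 | h6
      · rw [Fence.idx_injective h6]
      · obtain ⟨z, hz⟩ := Fence.exists_idx_eq (α := α) (i := x.idx - 1) (by omega)
        have hzy : z ≤ y := Fence.le_iff.2 (.inr ⟨by omega, fun j _ _ => h5 j (by omega) (by omega)⟩)
        exact absurd (hz ▸ hp.of_le hzy hy)
          (h3 _ (by omega) (h5 _ (by omega) (by omega)))

theorem minimal_compl_lowerSetOf_iff {p : ℕ → Prop} (hp : StepClosed α p) {x : Fence α} :
    Minimal (· ∉ lowerSetOf p hp) x ↔
      ¬ p x.idx ∧ (x.idx + 1 < α.sum - 1 → ¬ IsUp α x.idx → p (x.idx + 1)) ∧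
        (∀ j, j + 1 = x.idx → IsUp α j → p j) := by
  have hx := x.idx_lt
  constructor
  · intro h
    refine ⟨h.1, fun h1 h2 => ?_, fun j h1 h2 => ?_⟩ <;> by_contra h3
    · obtain ⟨y, hy⟩ := Fence.exists_idx_eq (α := α) h1
      have hxy : y ≤ x := Fence.le_iff.2 (.inr ⟨by omega, fun j _ _ => by
        rwa [show j = x.idx by omega]⟩)
      have := h.eq_of_ge (y := y) (by rwa [mem_lowerSetOf, hy]) hxy
      subst this
      omega
    · obtain ⟨y, hy⟩ := Fence.exists_idx_eq (α := α) (i := j) (by omega)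
      have hxy : y ≤ x := Fence.le_iff.2 (.inl ⟨by omega, fun i _ _ => by
        rwa [show i = j by omega]⟩)
      have := h.eq_of_ge (y := y) (by rwa [mem_lowerSetOf, hy]) hxy
      subst this
      omega
  · rintro ⟨h1, h2, h3⟩
    refine ⟨h1, fun y hy hxy => ?_⟩
    have hyl := y.idx_lt
    simp only [mem_lowerSetOf] at hy
    rcases Fence.le_iff.1 hxy with ⟨h4, h5⟩ | ⟨h4, h5⟩
    · rcases h4.eq_or_lt with h6 | h6
      · rw [Fence.idx_injective h6]
      · obtain ⟨z, hz⟩ := Fence.exists_idx_eq (α := α) (i := x.idx - 1) (by omega)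
        have hyz : y ≤ z := Fence.le_iff.2 (.inl ⟨by omega, fun j _ _ => h5 j (by omega) (by omega)⟩)
        refine absurd (hp.of_le hyz ?_) hy
        rw [hz]
        exact h3 _ (by omega) (h5 _ (by omega) (by omega))
    · rcases h4.eq_or_lt with h6 | h6
      · rw [Fence.idx_injective h6]
      · obtain ⟨z, hz⟩ := Fence.exists_idx_eq (α := α) (i := x.idx + 1) (by omega)
        have hyz : y ≤ z := Fence.le_iff.2 (.inr ⟨by omega, fun j _ _ => h5 j (by omega) (by omega)⟩)
        refine absurd (hp.of_le hyz ?_) hy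
        rw [hz]
        exact h2 (by omega) (h5 _ le_rfl h6)

end Fence

theorem rowmotionIdeal_eq_iff {P : Type*} [PartialOrder P] [Finite P] {I J : LowerSet P} :
    rowmotionIdeal P I = J ↔ ∀ x, Minimal (· ∉ I) x ↔ Maximal (· ∈ J) x := by
  have h : rowmotionIdeal P I = J ↔ minimals P (compl P I) = maximals P J := by
    rw [rowmotionIdeal, Equiv.trans_apply, Equiv.trans_apply, Equiv.symm_apply_eq]
  rw [h, Subtype.ext_iff, Set.ext_iff]
  exact Iff.rfl

theorem isUp_iff {a i : ℕ} :
    IsUp [a, a, a, a] i ↔ i + 1 < a ∨ (2 * a ≤ i + 1 ∧ i + 1 < 3 * a) := by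
  have h : Finset.Ico 1 [a, a, a, a].length = {1, 2, 3} := rfl
  rw [IsUp, h, Finset.card_filter, Finset.sum_insert (by decide), Finset.sum_insert (by decide),
    Finset.sum_singleton]
  simp only [List.take, List.sum_cons, List.sum_nil]
  by_cases h1 : a + 0 ≤ i + 1 <;> by_cases h2 : a + (a + 0) ≤ i + 1 <;>
    by_cases h3 : a + (a + (a + 0)) ≤ i + 1 <;>
    simp only [h1, h2, h3, if_true, if_false, Nat.even_iff] <;> omega

section Count

/-- The number of `i < n` that satisfy `p`. -/
noncomputable def countBelow (n : ℕ) (p : ℕ → Prop) : ℕ := {i | i < n ∧ p i}.ncard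

theorem ncard_fence {α : List ℕ} (p : ℕ → Prop) :
    {x : Fence α | p x.idx}.ncard = countBelow (α.sum - 1) p := by
  rw [countBelow, ← Set.ncard_image_of_injective _ Fence.idx_injective]
  congr 1
  ext i
  constructor
  · rintro ⟨x, hx, rfl⟩
    exact ⟨x.idx_lt, hx⟩
  · rintro ⟨hi, hp⟩
    obtain ⟨x, rfl⟩ := Fence.exists_idx_eq hi
    exact ⟨x, hp, rfl⟩

theorem countBelow_or {n : ℕ} {p q : ℕ → Prop} (h : ∀ i < n, p i → ¬ q i) :
    countBelow n (fun i => p i ∨ q i) = countBelow n p + countBelow n q := by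
  have hf : ∀ p : ℕ → Prop, {i | i < n ∧ p i}.Finite := fun p =>
    (Set.finite_lt_nat n).subset fun i hi => hi.1
  rw [countBelow, countBelow, countBelow, ← Set.ncard_union_eq _ (hf p) (hf q)]
  · congr 1
    ext i
    simp only [Set.mem_ofPred_eq, Set.mem_union]
    tauto
  · rw [Set.disjoint_left]
    exact fun i hi hi' => h i hi.1 hi.2 hi'.2

theorem countBelow_Ico {n : ℕ} {p : ℕ → Prop} (l u : ℕ) (h : ∀ i, i < n ∧ p i ↔ l ≤ i ∧ i < u) :
    countBelow n p = u - l := by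
  have : {i | i < n ∧ p i} = (Finset.Ico l u : Set ℕ) := by
    ext i
    simp [h]
  rw [countBelow, this, Set.ncard_coe_finset, Nat.card_Ico]

end Count

/-! ### States as ideals of the fence of four equal parts -/

theorem sum_parts (a : ℕ) : [a, a, a, a].sum = 4 * a := by simp; omega

theorem stepClosed_iff {a : ℕ} {p : ℕ → Prop} : StepClosed [a, a, a, a] p ↔
    ∀ i, i + 1 < 4 * a - 1 →
      ((i + 1 < a ∨ (2 * a ≤ i + 1 ∧ i + 1 < 3 * a)) → p (i + 1) → p i) ∧
      (¬ (i + 1 < a ∨ (2 * a ≤ i + 1 ∧ i + 1 < 3 * a)) → p i → p (i + 1)) := by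
  simp only [StepClosed, isUp_iff, sum_parts]

namespace State

variable {a : ℕ}

/-- Membership of the element with zero-based index `i` in the ideal encoded by a state. The left
peak, the valley and the right peak have the indices `a - 1`, `2 * a - 1` and `3 * a - 1`; the first
and the third chain are traversed upwards, the second and the fourth downwards. -/
def Mem : State a → ℕ → Prop
  | low x z, i => i < x.val ∨ 4 * a ≤ i + 1 + z.val
  | mid x y w z, i =>
    i < x.val ∨ (2 * a ≤ i + 1 + y.val ∧ i < 2 * a + w.val) ∨ 4 * a ≤ i + 1 + z.val
  | peakL w z, i => i < 2 * a + w.val ∨ 4 * a ≤ i + 1 + z.val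
  | peakR x y, i => i < x.val ∨ 2 * a ≤ i + 1 + y.val
  | peaks, _ => True

/-- The position of an index relative to the peaks and the valley. -/
theorem segment_cases (i : ℕ) :
    i + 1 < a ∨ i + 1 = a ∨ (a < i + 1 ∧ i + 1 < 2 * a) ∨ i + 1 = 2 * a ∨
    (2 * a < i + 1 ∧ i + 1 < 3 * a) ∨ i + 1 = 3 * a ∨ 3 * a < i + 1 := by omega

variable [NeZero a]

theorem stepClosed_mem (s : State a) : StepClosed [a, a, a, a] s.Mem := by
  rw [stepClosed_iff]
  intro i hi
  have hv : ∀ x : ZMod a, x.val < a := ZMod.val_lt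
  rcases s with ⟨x, z⟩ | ⟨x, y, w, z⟩ | ⟨w, z⟩ | ⟨x, y⟩ | _ <;> simp only [Mem]
  · have := hv x
    have := hv z
    omega
  · have := hv x
    have := hv z
    have := hv y
    have := hv w
    omega
  · have := hv w
    have := hv z
    omega
  · have := hv x
    have := hv y
    omega
  · simp

/-- The ideal encoded by a state. -/
def toLowerSet (s : State a) : LowerSet (Fence [a, a, a, a]) := lowerSetOf s.Mem s.stepClosed_mem

theorem toLowerSet_injective : Function.Injective (toLowerSet (a := a)) := by
  intro s s' h
  have h1 : ∀ i, i < 4 * a - 1 → (s.Mem i ↔ s'.Mem i) := by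
    intro i hi
    obtain ⟨x, rfl⟩ := Fence.exists_idx_eq (α := [a, a, a, a]) (i := i) (by simp; omega)
    rw [← mem_lowerSetOf (hp := s.stepClosed_mem), ← mem_lowerSetOf (hp := s'.stepClosed_mem)]
    exact SetLike.ext_iff.1 h x
  have hv : ∀ x : ZMod a, x.val < a := ZMod.val_lt
  have hi : ∀ x y : ZMod a, x.val = y.val → x = y := fun x y => @ZMod.val_injective a _ x y
  have ha := NeZero.pos a
  -- The peaks and the valley determine the constructor, the ends of the segments the coordinates.
  have p1 := h1 (a - 1) (by omega)
  have p2 := h1 (2 * a - 1) (by omega)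
  have p3 := h1 (3 * a - 1) (by omega)
  rcases s with ⟨x, z⟩ | ⟨x, y, w, z⟩ | ⟨w, z⟩ | ⟨x, y⟩ | _ <;>
    rcases s' with ⟨x', z'⟩ | ⟨x', y', w', z'⟩ | ⟨w', z'⟩ | ⟨x', y'⟩ | _ <;>
    simp only [Mem, iff_true, true_iff] at p1 p2 p3 h1
  · have := hv x; have := hv z; have := hv x'; have := hv z'
    have e1 := h1 x.val; have e2 := h1 x'.val
    have e3 := h1 (4 * a - 2 - z.val); have e4 := h1 (4 * a - 2 - z'.val)
    rw [hi x x' (by omega), hi z z' (by omega)]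
  · exfalso; have := hv x; have := hv z; have := hv x'; have := hv z'; omega
  · exfalso; have := hv x; have := hv z; have := hv z'; omega
  · exfalso; have := hv x; have := hv z; have := hv x'; omega
  · exfalso; have := hv x; have := hv z; omega
  · exfalso; have := hv x; have := hv z; have := hv x'; have := hv z'; omega
  · have := hv x; have := hv z; have := hv x'; have := hv z'
    have := hv y; have := hv w; have := hv y'; have := hv w'
    have ex : x = x' := by
      have e1 := h1 x.val; have e2 := h1 x'.val
      exact hi _ _ (by omega)
    have ey : y = y' := by
      have e1 := h1 (2 * a - 2 - y.val); have e2 := h1 (2 * a - 2 - y'.val)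
      exact hi _ _ (by omega)
    have ew : w = w' := by
      have e1 := h1 (2 * a + w.val); have e2 := h1 (2 * a + w'.val)
      exact hi _ _ (by omega)
    have ez : z = z' := by
      have e1 := h1 (4 * a - 2 - z.val); have e2 := h1 (4 * a - 2 - z'.val)
      exact hi _ _ (by omega)
    rw [ex, ey, ew, ez]
  · exfalso; have := hv x; have := hv y; have := hv z; omega
  · exfalso; have := hv x; have := hv w; have := hv z; omega
  · exfalso; have := hv x; have := hv y; have := hv z; omega
  · exfalso; have := hv x'; have := hv z; have := hv z'; omega
  · exfalso; have := hv x'; have := hv y'; have := hv z'; omega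
  · have := hv w; have := hv z; have := hv w'; have := hv z'
    have e1 := h1 (2 * a + w.val); have e2 := h1 (2 * a + w'.val)
    have e3 := h1 (4 * a - 2 - z.val); have e4 := h1 (4 * a - 2 - z'.val)
    rw [hi w w' (by omega), hi z z' (by omega)]
  · exfalso; have := hv x'; have := hv y'; omega
  · exfalso; have := hv w; have := hv z; omega
  · exfalso; have := hv x; have := hv z'; have := hv x'; omega
  · exfalso; have := hv x'; have := hv w'; have := hv z'; omega
  · exfalso; have := hv w'; have := hv z'; omega
  · have := hv x; have := hv y; have := hv x'; have := hv y'
    have e1 := h1 x.val; have e2 := h1 x'.val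
    have e3 := h1 (2 * a - 2 - y.val); have e4 := h1 (2 * a - 2 - y'.val)
    rw [hi x x' (by omega), hi y y' (by omega)]
  · exfalso; have := hv x; have := hv y; omega
  · exfalso; have := hv x'; have := hv z'; omega
  · exfalso; have := hv x'; have := hv y'; have := hv z'; omega
  · exfalso; have := hv w'; have := hv z'; omega
  · exfalso; have := hv x'; have := hv y'; omega
  · rfl

theorem exists_initial_segment {p : ℕ → Prop} {N : ℕ} (h : ∀ i, i + 1 < N → p (i + 1) → p i) :
    ∃ x ≤ N, ∀ i < N, (p i ↔ i < x) := by
  induction N with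
  | zero => exact ⟨0, le_rfl, fun i hi => absurd hi (Nat.not_lt_zero i)⟩
  | succ N ih =>
    obtain ⟨x, hx, hx'⟩ := ih fun i hi => h i (by omega)
    by_cases hN : p N
    · refine ⟨N + 1, le_rfl, fun i hi => iff_of_true ?_ hi⟩
      exact Nat.decreasingInduction' (P := p) (fun k hk _ hk' => h k (by omega) hk') (by omega) hN
    · refine ⟨x, by omega, fun i hi => ?_⟩
      rcases (Nat.lt_succ_iff.1 hi).eq_or_lt with rfl | h1
      · exact iff_of_false hN (by omega)
      · exact hx' i h1

theorem toLowerSet_surjective (ha : 1 < a) : Function.Surjective (toLowerSet (a := a)) := by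
  intro I
  obtain ⟨p, hp⟩ : ∃ p : ℕ → Prop, p = fun i => ∃ x ∈ I, x.idx = i := ⟨_, rfl⟩
  have hs : StepClosed [a, a, a, a] p := hp ▸ stepClosed_of_lowerSet I
  rw [stepClosed_iff] at hs
  suffices h : ∃ s : State a, ∀ i < 4 * a - 1, (s.Mem i ↔ p i) by
    obtain ⟨s, h⟩ := h
    refine ⟨s, ?_⟩
    ext e
    have he := e.idx_lt
    rw [sum_parts] at he
    change s.Mem e.idx ↔ e ∈ I
    rw [h _ he, hp]
    exact ⟨fun ⟨x, hx, h⟩ => Fence.idx_injective h ▸ hx, fun h => ⟨e, h, rfl⟩⟩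
  clear hp I
  -- Each chain is numbered from its bottom, hence the reversed indices in the second and the fourth.
  obtain ⟨x, hx, hx'⟩ := exists_initial_segment (p := p) (N := a - 1)
    fun i hi => (hs i (by omega)).1 (by omega)
  obtain ⟨y, hy, hy'⟩ := exists_initial_segment (p := fun j => p (2 * a - 2 - j)) (N := a - 1)
    fun i hi h => by
      have := (hs (2 * a - 2 - (i + 1)) (by omega)).2 (by omega) h
      rwa [show 2 * a - 2 - (i + 1) + 1 = 2 * a - 2 - i by omega] at this
  obtain ⟨w, hw, hw'⟩ := exists_initial_segment (p := fun j => p (2 * a + j)) (N := a - 1)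
    fun i hi => (hs (2 * a + i) (by omega)).1 (by omega)
  obtain ⟨z, hz, hz'⟩ := exists_initial_segment (p := fun j => p (4 * a - 2 - j)) (N := a - 1)
    fun i hi h => by
      have := (hs (4 * a - 2 - (i + 1)) (by omega)).2 (by omega) h
      rwa [show 4 * a - 2 - (i + 1) + 1 = 4 * a - 2 - i by omega] at this
  have hv : ∀ n : ℕ, n ≤ a - 1 → (n : ZMod a).val = n := fun n h => ZMod.val_cast_of_lt (by omega)
  have r1 : ∀ i, i + 1 < a → (p i ↔ i < x) := fun i hi => hx' i (by omega)
  have r2 : ∀ i, a < i + 1 → i + 1 < 2 * a → (p i ↔ 2 * a ≤ i + 1 + y) := fun i h1 h2 => by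
    have h := hy' (2 * a - 2 - i) (by omega)
    rw [show 2 * a - 2 - (2 * a - 2 - i) = i by omega] at h
    rw [h]
    omega
  have r3 : ∀ i, 2 * a < i + 1 → i + 1 < 3 * a → (p i ↔ i < 2 * a + w) := fun i h1 h2 => by
    have h := hw' (i - 2 * a) (by omega)
    rw [show 2 * a + (i - 2 * a) = i by omega] at h
    rw [h]
    omega
  have r4 : ∀ i, 3 * a < i + 1 → i + 1 < 4 * a → (p i ↔ 4 * a ≤ i + 1 + z) := fun i h1 h2 => by
    have h := hz' (4 * a - 2 - i) (by omega)
    rw [show 4 * a - 2 - (4 * a - 2 - i) = i by omega] at h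
    rw [h]
    omega
  -- The peaks and the valley constrain the two ends of each chain.
  have v1 : p (a - 1) → x = a - 1 := fun h => by
    have h := (hs (a - 2) (by omega)).1 (by omega) (by rwa [show a - 2 + 1 = a - 1 by omega])
    have := (r1 _ (by omega)).1 h
    omega
  have v2 : p (a - 1) → y = a - 1 := fun h => by
    have h := (hs (a - 1) (by omega)).2 (by omega) h
    have := (r2 _ (by omega) (by omega)).1 h
    omega
  have v3 : 0 < y → p (2 * a - 1) := fun h => by
    have h := (hs (2 * a - 2) (by omega)).2 (by omega) ((r2 _ (by omega) (by omega)).2 (by omega))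
    rwa [show 2 * a - 2 + 1 = 2 * a - 1 by omega] at h
  have v4 : 0 < w → p (2 * a - 1) := fun h => by
    refine (hs (2 * a - 1) (by omega)).1 (by omega) ?_
    exact (r3 _ (by omega) (by omega)).2 (by omega)
  have v5 : p (3 * a - 1) → w = a - 1 := fun h => by
    have h := (hs (3 * a - 2) (by omega)).1 (by omega)
      (by rwa [show 3 * a - 2 + 1 = 3 * a - 1 by omega])
    have := (r3 _ (by omega) (by omega)).1 h
    omega
  have v6 : p (3 * a - 1) → z = a - 1 := fun h => by
    have h := (hs (3 * a - 1) (by omega)).2 (by omega) h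
    have := (r4 _ (by omega) (by omega)).1 h
    omega
  suffices h : ∃ s : State a, (s.Mem (a - 1) ↔ p (a - 1)) ∧ (s.Mem (2 * a - 1) ↔ p (2 * a - 1)) ∧
      (s.Mem (3 * a - 1) ↔ p (3 * a - 1)) ∧ (∀ i, i + 1 < a → (s.Mem i ↔ i < x)) ∧
      (∀ i, a < i + 1 → i + 1 < 2 * a → (s.Mem i ↔ 2 * a ≤ i + 1 + y)) ∧
      (∀ i, 2 * a < i + 1 → i + 1 < 3 * a → (s.Mem i ↔ i < 2 * a + w)) ∧
      (∀ i, 3 * a < i + 1 → i + 1 < 4 * a → (s.Mem i ↔ 4 * a ≤ i + 1 + z)) by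
    obtain ⟨s, h1, h2, h3, h4, h5, h6, h7⟩ := h
    refine ⟨s, fun i hi => ?_⟩
    rcases segment_cases (a := a) i with hi' | hi' | hi' | hi' | hi' | hi' | hi'
    · rw [h4 i hi', r1 i hi']
    · rw [show i = a - 1 by omega, h1]
    · rw [h5 i hi'.1 hi'.2, r2 i hi'.1 hi'.2]
    · rw [show i = 2 * a - 1 by omega, h2]
    · rw [h6 i hi'.1 hi'.2, r3 i hi'.1 hi'.2]
    · rw [show i = 3 * a - 1 by omega, h3]
    · rw [h7 i hi' (by omega), r4 i hi' (by omega)]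
  clear r1 r2 r3 r4 hs hx' hy' hw' hz'
  have hvx := hv x hx
  have hvy := hv y hy
  have hvw := hv w hw
  have hvz := hv z hz
  by_cases b1 : p (a - 1) <;> by_cases b3 : p (3 * a - 1)
  · refine ⟨peaks, ?_⟩
    have b2 := v3 (by have := v2 b1; omega)
    refine ⟨?_, ?_, ?_, ?_, ?_, ?_, ?_⟩ <;> intros <;>
        simp only [Mem, b1, b3, b2, true_iff, v1 b1, v2 b1, v5 b3, v6 b3] <;>
        omega
  · refine ⟨peakL w z, ?_⟩
    have b2 := v3 (by have := v2 b1; omega)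
    refine ⟨?_, ?_, ?_, ?_, ?_, ?_, ?_⟩ <;> intros <;>
        simp only [Mem, b1, b3, b2, iff_true, iff_false, v1 b1, v2 b1, hvw, hvz] <;>
        omega
  · refine ⟨peakR x y, ?_⟩
    have b2 := v4 (by have := v5 b3; omega)
    refine ⟨?_, ?_, ?_, ?_, ?_, ?_, ?_⟩ <;> intros <;>
        simp only [Mem, b1, b3, b2, iff_true, iff_false, v5 b3, v6 b3, hvx, hvy] <;>
        omega
  · by_cases b2 : p (2 * a - 1)
    · refine ⟨mid x y w z, ?_⟩
      refine ⟨?_, ?_, ?_, ?_, ?_, ?_, ?_⟩ <;> intros <;>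
        simp only [Mem, b1, b2, b3, iff_true, iff_false, hvx, hvy, hvw, hvz] <;>
        omega
    · refine ⟨low x z, ?_⟩
      obtain rfl : y = 0 := Nat.eq_zero_of_not_pos fun h => b2 (v3 h)
      obtain rfl : w = 0 := Nat.eq_zero_of_not_pos fun h => b2 (v4 h)
      refine ⟨?_, ?_, ?_, ?_, ?_, ?_, ?_⟩ <;> intros <;>
        simp only [Mem, b1, b2, b3, iff_false, hvx, hvz] <;>
        omega

/-! ### The step is rowmotion -/

/-- The element with zero-based index `i` is maximal in the ideal encoded by a state. -/
def IsMaximal : State a → ℕ → Prop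
  | low x z, i => i + 1 = x.val ∨ (i + 1 + z.val = 4 * a ∧ 0 < z.val)
  | mid x y w z, i => i + 1 = x.val ∨ (i + 1 + y.val = 2 * a ∧ 0 < y.val) ∨
    (i + 1 = 2 * a + w.val ∧ 0 < w.val) ∨ (i + 1 + z.val = 4 * a ∧ 0 < z.val) ∨
    (i + 1 = 2 * a ∧ y.val = 0 ∧ w.val = 0)
  | peakL w z, i => (i + 1 = 2 * a + w.val ∧ 0 < w.val) ∨ (i + 1 + z.val = 4 * a ∧ 0 < z.val) ∨
    i + 1 = a
  | peakR x y, i => i + 1 = x.val ∨ (i + 1 + y.val = 2 * a ∧ 0 < y.val) ∨ i + 1 = 3 * a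
  | peaks, i => i + 1 = a ∨ i + 1 = 3 * a

/-- The element with zero-based index `i` is minimal in the complement of the ideal encoded by a
state. -/
def IsMinimal : State a → ℕ → Prop
  | low x z, i => (i = x.val ∧ x.val + 1 < a) ∨ (i + 2 + z.val = 4 * a ∧ z.val + 1 < a) ∨
    i + 1 = 2 * a
  | mid x y w z, i => (i = x.val ∧ x.val + 1 < a) ∨ (i + 2 + y.val = 2 * a ∧ y.val + 1 < a) ∨
    (i = 2 * a + w.val ∧ w.val + 1 < a) ∨ (i + 2 + z.val = 4 * a ∧ z.val + 1 < a) ∨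
    (i + 1 = a ∧ x.val + 1 = a ∧ y.val + 1 = a) ∨ (i + 1 = 3 * a ∧ w.val + 1 = a ∧ z.val + 1 = a)
  | peakL w z, i => (i = 2 * a + w.val ∧ w.val + 1 < a) ∨
    (i + 2 + z.val = 4 * a ∧ z.val + 1 < a) ∨ (i + 1 = 3 * a ∧ w.val + 1 = a ∧ z.val + 1 = a)
  | peakR x y, i => (i = x.val ∧ x.val + 1 < a) ∨ (i + 2 + y.val = 2 * a ∧ y.val + 1 < a) ∨
    (i + 1 = a ∧ x.val + 1 = a ∧ y.val + 1 = a)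
  | peaks, _ => False

theorem forall_add_one_eq_iff {p : ℕ → Prop} {i : ℕ} :
    (∀ j, j + 1 = i → p j) ↔ (0 < i → p (i - 1)) :=
  ⟨fun h h1 => h _ (by omega), fun h j hj => by
    rw [show j = i - 1 by omega]; exact h (by omega)⟩

set_option maxHeartbeats 1000000 in
theorem maximal_toLowerSet_iff (ha : 1 < a) (s : State a) (e : Fence [a, a, a, a]) :
    Maximal (· ∈ s.toLowerSet) e ↔ s.IsMaximal e.idx := by
  have he := e.idx_lt
  rw [toLowerSet, maximal_lowerSetOf_iff, forall_add_one_eq_iff]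
  simp only [isUp_iff, sum_parts] at he ⊢
  generalize e.idx = i at *
  have hi := segment_cases (a := a) i
  have hv : ∀ x : ZMod a, x.val < a := ZMod.val_lt
  rcases s with ⟨x, z⟩ | ⟨x, y, w, z⟩ | ⟨w, z⟩ | ⟨x, y⟩ | _ <;> simp only [Mem, IsMaximal]
  · have hx := hv x
    have hz := hv z
    omega
  · have hx := hv x
    have hy := hv y
    have hw := hv w
    have hz := hv z
    rcases hi with hi | hi | hi | hi | hi | hi | hi <;> omega
  · have hw := hv w
    have hz := hv z
    rcases hi with hi | hi | hi | hi | hi | hi | hi <;> omega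
  · have hx := hv x
    have hy := hv y
    rcases hi with hi | hi | hi | hi | hi | hi | hi <;> omega
  · simp only [not_true_eq_false, true_and, imp_false]
    omega

set_option maxHeartbeats 1000000 in
theorem minimal_compl_toLowerSet_iff (ha : 1 < a) (s : State a) (e : Fence [a, a, a, a]) :
    Minimal (· ∉ s.toLowerSet) e ↔ s.IsMinimal e.idx := by
  have he := e.idx_lt
  rw [toLowerSet, minimal_compl_lowerSetOf_iff, forall_add_one_eq_iff]
  simp only [isUp_iff, sum_parts] at he ⊢
  generalize e.idx = i at *
  have hi := segment_cases (a := a) i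
  have hv : ∀ x : ZMod a, x.val < a := ZMod.val_lt
  rcases s with ⟨x, z⟩ | ⟨x, y, w, z⟩ | ⟨w, z⟩ | ⟨x, y⟩ | _ <;> simp only [Mem, IsMinimal]
  · have hx := hv x
    have hz := hv z
    omega
  · have hx := hv x
    have hy := hv y
    have hw := hv w
    have hz := hv z
    rcases hi with hi | hi | hi | hi | hi | hi | hi <;> omega
  · have hw := hv w
    have hz := hv z
    rcases hi with hi | hi | hi | hi | hi | hi | hi <;> omega
  · have hx := hv x
    have hy := hv y
    rcases hi with hi | hi | hi | hi | hi | hi | hi <;> omega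
  · simp

/-- The maximal elements after a step are the minimal elements of the complement before it, which is
the defining property of rowmotion on ideals. -/
theorem isMaximal_step_iff (ha : 1 < a) (s : State a) (i : ℕ) :
    s.step.IsMaximal i ↔ s.IsMinimal i := by
  have hn : ∀ x : ZMod a, x = -1 ↔ x.val + 1 = a := by
    refine fun x => ⟨fun h => h ▸ val_neg_one_add, fun h => ?_⟩
    rw [← (natCast_eq_neg_one_iff (ZMod.val_lt x)).2 h, ZMod.natCast_zmod_val]
  have h1 : ∀ x : ZMod a, (x.val + 1 = a ∧ (x + 1).val = 0) ∨
      (x.val + 1 < a ∧ (x + 1).val = x.val + 1) := by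
    intro x
    by_cases hx : x = -1
    · exact .inl ⟨(hn x).1 hx, by simp [hx]⟩
    · have := ZMod.val_lt (x + 1)
      rw [val_add_one_of_ne hx] at this
      exact .inr ⟨this, val_add_one_of_ne hx⟩
  -- The top element of the chain after the step is the next free element of the chain before the
  -- step; there is none if the chain is full before, equivalently empty after the step.
  have hA : ∀ x : ZMod a, i + 1 = (x + 1).val ↔ i = x.val ∧ x.val + 1 < a := fun x => by
    have := h1 x
    omega
  have hB : ∀ N (x : ZMod a), i + 1 + (x + 1).val = N ∧ 0 < (x + 1).val ↔
      i + 2 + x.val = N ∧ x.val + 1 < a := fun N x => by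
    have := h1 x
    omega
  have hC : ∀ x : ZMod a, i + 1 = 2 * a + (x + 1).val ∧ 0 < (x + 1).val ↔
      i = 2 * a + x.val ∧ x.val + 1 < a := fun x => by
    have := h1 x
    omega
  have hD : ∀ x : ZMod a, (x + 1).val = 0 ↔ x.val + 1 = a := fun x => by
    have := h1 x
    omega
  rcases s with ⟨x, z⟩ | ⟨x, y, w, z⟩ | ⟨w, z⟩ | ⟨x, y⟩ | _
  · simp only [step, IsMaximal, IsMinimal, hA, hB, ZMod.val_zero, and_true, lt_self_iff_false,
      and_false, false_or]
  · simp only [step, hn]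
    split_ifs <;> simp only [IsMaximal, IsMinimal, hA, hB, hC, hD] <;> clear h1 hn hA hB hC hD <;>
      grind
  · simp only [step, hn]
    split_ifs <;> simp only [IsMaximal, IsMinimal, hB, hC, hD, ZMod.val_zero,
      true_and, lt_self_iff_false, and_false, false_or] <;> omega
  · simp only [step, hn]
    split_ifs <;> simp only [IsMaximal, IsMinimal, hA, hB, hD, ZMod.val_zero, and_true,
      lt_self_iff_false, and_false, or_false, false_or] <;> omega
  · simp [step, IsMaximal, IsMinimal]

theorem rowmotionIdeal_toLowerSet (ha : 1 < a) (s : State a) :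
    rowmotionIdeal _ s.toLowerSet = s.step.toLowerSet := by
  rw [rowmotionIdeal_eq_iff]
  intro e
  rw [minimal_compl_toLowerSet_iff ha, maximal_toLowerSet_iff ha, isMaximal_step_iff ha]

/-! ### Cardinalities of the ideal and of the antichain of a state -/

theorem chiHat_toLowerSet (ha : 1 < a) (s : State a) : (chiHat s.toLowerSet : ℤ) = s.idealCard := by
  have h : chiHat s.toLowerSet = countBelow (4 * a - 1) s.Mem := by
    rw [← sum_parts, ← ncard_fence]
    rfl
  have hv : ∀ x : ZMod a, x.val < a := ZMod.val_lt
  have hx : ∀ x : ZMod a, countBelow (4 * a - 1) (fun i => i < x.val) = x.val := fun x => by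
    have := hv x
    rw [countBelow_Ico 0 x.val (fun i => by omega), Nat.sub_zero]
  have hz : ∀ z : ZMod a, countBelow (4 * a - 1) (fun i => 4 * a ≤ i + 1 + z.val) = z.val :=
    fun z => by
      have := hv z
      rw [countBelow_Ico (4 * a - 1 - z.val) (4 * a - 1) (fun i => by omega)]
      omega
  rw [h]
  rcases s with ⟨x, z⟩ | ⟨x, y, w, z⟩ | ⟨w, z⟩ | ⟨x, y⟩ | _
  · have h : (low x z).Mem = fun i => i < x.val ∨ 4 * a ≤ i + 1 + z.val := rfl
    rw [h, countBelow_or, hx, hz]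
    · simp [idealCard]
    · have := hv x
      have := hv z
      omega
  · have := hv x
    have := hv y
    have := hv w
    have := hv z
    have h : (mid x y w z).Mem = fun i => i < x.val ∨
      (2 * a ≤ i + 1 + y.val ∧ i < 2 * a + w.val) ∨ 4 * a ≤ i + 1 + z.val := rfl
    have h' : countBelow (4 * a - 1) (fun i => 2 * a ≤ i + 1 + y.val ∧ i < 2 * a + w.val) =
        y.val + w.val + 1 := by
      rw [countBelow_Ico (2 * a - 1 - y.val) (2 * a + w.val) (fun i => by omega)]
      omega
    rw [h, countBelow_or, countBelow_or, hx, hz, h']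
    · simp only [idealCard]
      omega
    · omega
    · omega
  · have := hv w
    have := hv z
    have h : (peakL w z).Mem = fun i => i < 2 * a + w.val ∨ 4 * a ≤ i + 1 + z.val := rfl
    rw [h, countBelow_or, hz, countBelow_Ico 0 (2 * a + w.val)]
    · simp only [idealCard]
      omega
    · omega
    · omega
  · have := hv x
    have := hv y
    have h : (peakR x y).Mem = fun i => i < x.val ∨ 2 * a ≤ i + 1 + y.val := rfl
    rw [h, countBelow_or, hx, countBelow_Ico (2 * a - 1 - y.val) (4 * a - 1)]
    · simp only [idealCard]
      omega
    · omega
    · omega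
  · rw [countBelow_Ico 0 (4 * a - 1) (fun i => by simp [Mem])]
    simp only [idealCard]
    omega

theorem chi_maximals_toLowerSet (ha : 1 < a) (s : State a) :
    (chi (maximals _ s.toLowerSet) : ℤ) = s.antichainCard := by
  have h : chi (maximals _ s.toLowerSet) = countBelow (4 * a - 1) s.IsMaximal := by
    rw [← sum_parts, ← ncard_fence]
    simp only [← maximal_toLowerSet_iff ha]
    rfl
  have hv : ∀ x : ZMod a, x.val < a := ZMod.val_lt
  have hp : ∀ x : ZMod a, pos x = if 0 < x.val then 1 else 0 := fun x => by
    simp only [pos, Nat.pos_iff_ne_zero, ne_eq, ZMod.val_eq_zero, ite_not]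
  have h1 : ∀ x : ZMod a, (countBelow (4 * a - 1) (fun i => i + 1 = x.val) : ℤ) = pos x :=
    fun x => by
      have := hv x
      rw [countBelow_Ico (x.val - 1) x.val (fun i => by omega), hp]
      split_ifs <;> omega
  have h2 : ∀ x : ZMod a,
      (countBelow (4 * a - 1) (fun i => i + 1 + x.val = 2 * a ∧ 0 < x.val) : ℤ) = pos x :=
    fun x => by
      have := hv x
      rw [hp]
      split_ifs with hx
      · rw [countBelow_Ico (2 * a - 1 - x.val) (2 * a - x.val) (fun i => by omega)]
        omega
      · rw [countBelow_Ico 0 0 (fun i => by omega)]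
        rfl
  have h3 : ∀ x : ZMod a,
      (countBelow (4 * a - 1) (fun i => i + 1 = 2 * a + x.val ∧ 0 < x.val) : ℤ) = pos x :=
    fun x => by
      have := hv x
      rw [hp]
      split_ifs with hx
      · rw [countBelow_Ico (2 * a + x.val - 1) (2 * a + x.val) (fun i => by omega)]
        omega
      · rw [countBelow_Ico 0 0 (fun i => by omega)]
        rfl
  have h4 : ∀ x : ZMod a,
      (countBelow (4 * a - 1) (fun i => i + 1 + x.val = 4 * a ∧ 0 < x.val) : ℤ) = pos x :=
    fun x => by
      have := hv x
      rw [hp]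
      split_ifs with hx
      · rw [countBelow_Ico (4 * a - 1 - x.val) (4 * a - x.val) (fun i => by omega)]
        omega
      · rw [countBelow_Ico 0 0 (fun i => by omega)]
        rfl
  have h5 : ∀ k, 0 < k → k < 4 * a → countBelow (4 * a - 1) (fun i => i + 1 = k) = 1 :=
    fun k hk hk' => by
      rw [countBelow_Ico (k - 1) k (fun i => by omega)]
      omega
  rw [h]
  rcases s with ⟨x, z⟩ | ⟨x, y, w, z⟩ | ⟨w, z⟩ | ⟨x, y⟩ | _
  · have h : (low x z).IsMaximal = fun i =>
      i + 1 = x.val ∨ (i + 1 + z.val = 4 * a ∧ 0 < z.val) := rfl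
    rw [h, countBelow_or]
    · push_cast
      rw [h1, h4]
      rfl
    · have := hv x
      have := hv z
      omega
  · have := hv x
    have := hv y
    have := hv w
    have := hv z
    have h : (mid x y w z).IsMaximal = fun i =>
      i + 1 = x.val ∨ (i + 1 + y.val = 2 * a ∧ 0 < y.val) ∨
      (i + 1 = 2 * a + w.val ∧ 0 < w.val) ∨ (i + 1 + z.val = 4 * a ∧ 0 < z.val) ∨
      (i + 1 = 2 * a ∧ y.val = 0 ∧ w.val = 0) := rfl
    have h6 : (countBelow (4 * a - 1) (fun i => i + 1 = 2 * a ∧ y.val = 0 ∧ w.val = 0) : ℤ) =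
        if y = 0 ∧ w = 0 then 1 else 0 := by
      simp only [← ZMod.val_eq_zero]
      split_ifs with hyw
      · rw [countBelow_Ico (2 * a - 1) (2 * a) (fun i => by omega)]
        omega
      · rw [countBelow_Ico 0 0 (fun i => by omega)]
        rfl
    rw [h, countBelow_or, countBelow_or, countBelow_or, countBelow_or]
    · push_cast
      rw [h1, h2, h3, h4, h6]
      simp only [antichainCard]
      ring
    all_goals omega
  · have := hv w
    have := hv z
    have h : (peakL w z).IsMaximal = fun i => (i + 1 = 2 * a + w.val ∧ 0 < w.val) ∨
      (i + 1 + z.val = 4 * a ∧ 0 < z.val) ∨ i + 1 = a := rfl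
    rw [h, countBelow_or, countBelow_or, h5 a (by omega) (by omega)]
    · push_cast
      rw [h3, h4]
      simp only [antichainCard]
      ring
    all_goals omega
  · have := hv x
    have := hv y
    have h : (peakR x y).IsMaximal = fun i =>
      i + 1 = x.val ∨ (i + 1 + y.val = 2 * a ∧ 0 < y.val) ∨ i + 1 = 3 * a := rfl
    rw [h, countBelow_or, countBelow_or, h5 (3 * a) (by omega) (by omega)]
    · push_cast
      rw [h1, h2]
      simp only [antichainCard]
      ring
    all_goals omega
  · have h : (peaks : State a).IsMaximal = fun i => i + 1 = a ∨ i + 1 = 3 * a := rfl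
    rw [h, countBelow_or, h5 a (by omega) (by omega), h5 (3 * a) (by omega) (by omega)]
    · rfl
    · omega

end State

/-! ### Orbits of conjugate permutations -/

theorem mem_orbits_iff {X : Type*} [Fintype X] {f : Equiv.Perm X} {O : Finset X} :
    O ∈ orbits f ↔ ∃ x, ∀ y, y ∈ O ↔ f.SameCycle x y := by
  classical
  simp only [orbits, Finset.mem_image, Finset.mem_univ, true_and]
  refine exists_congr fun x => ?_
  rw [Finset.ext_iff]
  simp only [Finset.mem_filter, Finset.mem_univ, true_and]
  exact forall_congr' fun y => Iff.comm

/-- A bijection that intertwines two permutations maps the orbits of one to the orbits of the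
other. -/
theorem mem_orbits_conj {X Y : Type*} [Fintype X] [Fintype Y] (e : X ≃ Y) {f : Equiv.Perm X}
    {g : Equiv.Perm Y} (h : ∀ x, e (f x) = g (e x)) (Q : Finset Y) :
    Q ∈ orbits g ↔ ∃ O ∈ orbits f, O.map e.toEmbedding = Q := by
  have hg : g = e.permCongr f := by
    ext y
    simp [Equiv.permCongr_apply, h]
  have hc : ∀ x x', g.SameCycle (e x) (e x') ↔ f.SameCycle x x' := fun x x' => by
    have hz : ∀ n : ℤ, (e.permCongr f) ^ n = e.permCongr (f ^ n) := fun n =>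
      (map_zpow (Equiv.permCongrHom e) f n).symm
    simp only [Equiv.Perm.SameCycle, hg, hz, Equiv.permCongr_apply, Equiv.symm_apply_apply,
      e.injective.eq_iff]
  simp only [mem_orbits_iff]
  constructor
  · rintro ⟨y, hy⟩
    refine ⟨Q.map e.symm.toEmbedding, ⟨e.symm y, fun x => ?_⟩, ?_⟩
    · rw [← hc, e.apply_symm_apply, ← hy]
      simp [Finset.mem_map_equiv]
    · ext x
      simp [Finset.mem_map_equiv]
  · rintro ⟨O, ⟨x, hx⟩, rfl⟩
    refine ⟨e x, fun y => ?_⟩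
    obtain ⟨x', rfl⟩ := e.surjective y
    rw [hc, ← hx]
    simp

theorem maximals_symm_rowmotion {P : Type*} [PartialOrder P] [Finite P] (A : Antichains P) :
    (maximals P).symm (rowmotion P A) = rowmotionIdeal P ((maximals P).symm A) := rfl

/-- A statistic is orbomesic if its total over an orbit is a function of the size of the orbit. -/
theorem isOrbomesic_of_total_eq {X : Type*} [Fintype X] {f : Equiv.Perm X} {st : X → ℕ} (F : ℕ → ℤ)
    (h : ∀ O ∈ orbits f, (total st O : ℤ) = F O.card) : IsOrbomesic f st := by
  intro O₁ h₁ O₂ h₂ hc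
  have := h O₁ h₁
  rw [hc, ← h O₂ h₂] at this
  exact_mod_cast this

/-! ### Orbits of rowmotion -/

namespace State

variable {a : ℕ} [NeZero a]

/-- The bijection between states and ideals. -/
noncomputable def equivLowerSet (ha : 1 < a) : State a ≃ LowerSet (Fence [a, a, a, a]) :=
  Equiv.ofBijective toLowerSet ⟨toLowerSet_injective, toLowerSet_surjective ha⟩

/-- The bijection between states and antichains: the maximal elements of the ideal. -/
noncomputable def equivAntichains (ha : 1 < a) : State a ≃ Antichains (Fence [a, a, a, a]) :=
  (equivLowerSet ha).trans (maximals _)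

/-- The step as a permutation of the states, transported from rowmotion on ideals. -/
noncomputable def stepPerm (ha : 1 < a) : Equiv.Perm (State a) :=
  ((equivLowerSet ha).trans (rowmotionIdeal _)).trans (equivLowerSet ha).symm

theorem equivLowerSet_stepPerm (ha : 1 < a) (s : State a) :
    equivLowerSet ha (stepPerm ha s) = rowmotionIdeal _ (equivLowerSet ha s) := by
  simp [stepPerm]

theorem stepPerm_apply (ha : 1 < a) (s : State a) : stepPerm ha s = s.step := by
  apply (equivLowerSet ha).injective
  rw [equivLowerSet_stepPerm]
  exact rowmotionIdeal_toLowerSet ha s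

theorem equivAntichains_stepPerm (ha : 1 < a) (s : State a) :
    equivAntichains ha (stepPerm ha s) = rowmotion _ (equivAntichains ha s) := by
  apply (maximals _).symm.injective
  rw [maximals_symm_rowmotion]
  simp only [equivAntichains, Equiv.trans_apply, Equiv.symm_apply_apply]
  exact equivLowerSet_stepPerm ha s

/-- The antichains whose states have the label `l`. This is an orbit if it is nonempty. -/
noncomputable def orbitOf (ha : 1 < a) (l : Label a) : Finset (Antichains (Fence [a, a, a, a])) :=
  (fiber l).map (equivAntichains ha).toEmbedding

theorem mem_orbits_rowmotion_iff (ha : 1 < a) {O : Finset (Antichains (Fence [a, a, a, a]))} :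
    O ∈ orbits (rowmotion (Fence [a, a, a, a])) ↔
      ∃ l : Label a, (fiber l).Nonempty ∧ orbitOf ha l = O := by
  have : Fact (1 < a) := ⟨ha⟩
  rw [mem_orbits_conj _ (equivAntichains_stepPerm ha)]
  simp only [mem_orbits_iff, sameCycle_iff_label (stepPerm_apply ha)]
  constructor
  · rintro ⟨O', ⟨s, hs⟩, rfl⟩
    refine ⟨s.label, ⟨s, mem_fiber.2 rfl⟩, ?_⟩
    rw [orbitOf]
    congr 1
    ext s'
    rw [hs, mem_fiber, eq_comm]
  · rintro ⟨l, ⟨s, hs⟩, rfl⟩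
    refine ⟨fiber l, ⟨s, fun s' => ?_⟩, rfl⟩
    rw [mem_fiber.1 hs, mem_fiber, eq_comm]

theorem card_orbitOf (ha : 1 < a) (l : Label a) : (orbitOf ha l).card = (fiber l).card :=
  Finset.card_map _

theorem total_chi_orbitOf (ha : 1 < a) (l : Label a) :
    (total chi (orbitOf ha l) : ℤ) = ∑ s ∈ fiber l, antichainCard s := by
  rw [total, orbitOf, Finset.sum_map]
  push_cast
  exact Finset.sum_congr rfl fun s _ => chi_maximals_toLowerSet ha s

theorem total_chiHat_orbitOf (ha : 1 < a) (l : Label a) :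
    (total chiHat (idealsOf (orbitOf ha l)) : ℤ) = ∑ s ∈ fiber l, idealCard s := by
  rw [total, idealsOf, orbitOf, Finset.sum_map, Finset.sum_map]
  push_cast
  refine Finset.sum_congr rfl fun s _ => ?_
  simp only [equivAntichains, Equiv.coe_toEmbedding, Equiv.trans_apply, Equiv.symm_apply_apply]
  exact chiHat_toLowerSet ha s

theorem orbitOf_injOn (ha : 1 < a) : Set.InjOn (orbitOf ha) {l : Label a | (fiber l).Nonempty} := by
  rintro l ⟨s, hs⟩ l' - h
  have h' : fiber l = fiber l' := Finset.map_injective _ h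
  exact (mem_fiber.1 hs).symm.trans (mem_fiber.1 (h' ▸ hs : s ∈ fiber l'))

theorem fiber_nonempty_iff {l : Label a} : (fiber l).Nonempty ↔
    (∃ i j k, i ≠ 0 ∧ j ≠ 0 ∧ k ≠ 0 ∧ .S i j k = l) ∨ (∃ d, d ≠ 0 ∧ .M d = l) ∨
      .G 0 = l ∨ ∃ m, m ≠ 0 ∧ .G m = l := by
  have ha := NeZero.pos a
  constructor
  · rintro ⟨s, hs⟩
    rw [mem_fiber] at hs
    rcases l with ⟨i, j, k⟩ | d | m
    · obtain ⟨hi, hj, hk, -⟩ := label_eq_S_iff.1 hs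
      exact .inl ⟨i, j, k, hi, hj, hk, rfl⟩
    · exact .inr (.inl ⟨d, ne_zero_of_label_eq_M hs, rfl⟩)
    · by_cases hm : m = 0
      · exact .inr (.inr (.inl (by rw [hm])))
      · exact .inr (.inr (.inr ⟨m, hm, rfl⟩))
  · rintro (⟨i, j, k, hi, hj, hk, rfl⟩ | ⟨d, hd, rfl⟩ | rfl | ⟨m, hm, rfl⟩) <;>
      rw [← Finset.card_pos]
    · rw [card_fiber_S hi hj hk]
      exact ha
    · rw [card_fiber_M hd]
      omega
    · rw [card_fiber_G_zero]
      omega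
    · rw [card_fiber_G hm]
      omega

end State

open State in
/-- The classes are the images under `orbitOf` of the nonempty labels `S i j k`, `M d`, `G 0` and
`G m` with `m ≠ 0`. -/
theorem exists_orbit_classes (a : ℕ) (ha : 2 ≤ a) :
    ∃ S M L G : Finset (Finset (Antichains (Fence [a, a, a, a]))),
      ((∀ O, O ∈ orbits (rowmotion (Fence [a, a, a, a])) ↔ O ∈ S ∨ O ∈ M ∨ O ∈ L ∨ O ∈ G) ∧
        Disjoint S M ∧ Disjoint S L ∧ Disjoint S G ∧
        Disjoint M L ∧ Disjoint M G ∧ Disjoint L G) ∧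
      (S.card = (a - 1) ^ 3 ∧ M.card = a ∧ L.card = 1 ∧ G.card = a - 1) ∧
      ((∀ O ∈ S, O.card = a) ∧
        (∀ O ∈ M, O.card = a + 1) ∧
        (∀ O ∈ L, O.card = a ^ 2 + a + 1) ∧
        (∀ O ∈ G, O.card = 3 * a ^ 2 + a)) ∧
      ((∀ O ∈ S, (total chi O : ℤ) = 4 * a - 4) ∧
        (∀ O ∈ M, (total chi O : ℤ) = 4 * a - 2) ∧
        (∀ O ∈ L, (total chi O : ℤ) = 4 * a ^ 2 - a) ∧
        (∀ O ∈ G, (total chi O : ℤ) = 12 * a ^ 2 - 11 * a + 2)) ∧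
      ((∀ O ∈ S, (total chiHat (idealsOf O) : ℤ) = 2 * a ^ 2 - a) ∧
        (∀ O ∈ M, (total chiHat (idealsOf O) : ℤ) = 2 * a ^ 2 + 3 * a - 1) ∧
        (∀ O ∈ L, (total chiHat (idealsOf O) : ℤ) = 2 * a ^ 3 + 3 * a - 1) ∧
        (∀ O ∈ G, (total chiHat (idealsOf O) : ℤ) = 6 * a ^ 3 - a)) := by
  classical
  have : NeZero a := ⟨by omega⟩
  have ha' : 1 < a := ha
  let Z : Finset (ZMod a) := Finset.univ.erase 0
  have hZ : Z.card = a - 1 := by simp [Z, ZMod.card]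
  let TS : Finset (Label a) := (Z ×ˢ Z ×ˢ Z).image fun v => .S v.1 v.2.1 v.2.2
  let TM : Finset (Label a) := (Finset.univ.erase 0).image .M
  let TL : Finset (Label a) := {.G 0}
  let TG : Finset (Label a) := Z.image .G
  have mS : ∀ l, l ∈ TS ↔ ∃ i j k, i ≠ 0 ∧ j ≠ 0 ∧ k ≠ 0 ∧ .S i j k = l := fun l => by
    simp [TS, Z, and_assoc]
  have mM : ∀ l, l ∈ TM ↔ ∃ d, d ≠ 0 ∧ .M d = l := fun l => by simp [TM]
  have mL : ∀ l, l ∈ TL ↔ .G 0 = l := fun l => by simp [TL, eq_comm]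
  have mG : ∀ l, l ∈ TG ↔ ∃ m, m ≠ 0 ∧ .G m = l := fun l => by simp [TG, Z]
  have hne : ∀ l : Label a, (fiber l).Nonempty ↔ l ∈ TS ∨ l ∈ TM ∨ l ∈ TL ∨ l ∈ TG := fun l => by
    rw [fiber_nonempty_iff, mS, mM, mL, mG]
  -- Different nonempty labels have different orbits, so that counts and disjointness can be checked
  -- on labels.
  have hcard : ∀ T : Finset (Label a), (∀ l ∈ T, (fiber l).Nonempty) →
      (T.image (orbitOf ha')).card = T.card := fun T hT =>
    Finset.card_image_of_injOn ((orbitOf_injOn ha').mono fun l hl => hT l hl)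
  have hdisj : ∀ T T' : Finset (Label a), (∀ l ∈ T, (fiber l).Nonempty) →
      (∀ l ∈ T', (fiber l).Nonempty) → (∀ l ∈ T, l ∉ T') →
      Disjoint (T.image (orbitOf ha')) (T'.image (orbitOf ha')) := by
    intro T T' hT hT' h
    rw [Finset.disjoint_left]
    intro O hO hO'
    obtain ⟨l, hl, rfl⟩ := Finset.mem_image.1 hO
    obtain ⟨l', hl', h'⟩ := Finset.mem_image.1 hO'
    exact h l hl (orbitOf_injOn ha' (hT' l' hl') (hT l hl) h' ▸ hl')
  have nS : ∀ l ∈ TS, (fiber l).Nonempty := fun l hl => (hne l).2 (.inl hl)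
  have nM : ∀ l ∈ TM, (fiber l).Nonempty := fun l hl => (hne l).2 (.inr (.inl hl))
  have nL : ∀ l ∈ TL, (fiber l).Nonempty := fun l hl => (hne l).2 (.inr (.inr (.inl hl)))
  have nG : ∀ l ∈ TG, (fiber l).Nonempty := fun l hl => (hne l).2 (.inr (.inr (.inr hl)))
  refine ⟨TS.image (orbitOf ha'), TM.image (orbitOf ha'), TL.image (orbitOf ha'),
    TG.image (orbitOf ha'), ⟨fun O => ?_, hdisj _ _ nS nM ?_, hdisj _ _ nS nL ?_,
      hdisj _ _ nS nG ?_, hdisj _ _ nM nL ?_, hdisj _ _ nM nG ?_, hdisj _ _ nL nG ?_⟩,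
    ⟨?_, ?_, ?_, ?_⟩, ⟨?_, ?_, ?_, ?_⟩, ⟨?_, ?_, ?_, ?_⟩, ⟨?_, ?_, ?_, ?_⟩⟩
  · rw [mem_orbits_rowmotion_iff ha']
    simp only [hne, Finset.mem_image, or_and_right, exists_or]
  · intro l
    rw [mS, mM]
    rintro ⟨i, j, k, -, -, -, rfl⟩
    simp
  · intro l
    rw [mS, mL]
    rintro ⟨i, j, k, -, -, -, rfl⟩
    simp
  · intro l
    rw [mS, mG]
    rintro ⟨i, j, k, -, -, -, rfl⟩
    simp
  · intro l
    rw [mM, mL]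
    rintro ⟨d, -, rfl⟩
    simp
  · intro l
    rw [mM, mG]
    rintro ⟨d, -, rfl⟩
    simp
  · intro l
    rw [mL, mG]
    rintro rfl ⟨m, hm, h⟩
    exact hm (Label.G.inj h)
  · rw [hcard _ nS, Finset.card_image_of_injective, Finset.card_product, Finset.card_product, hZ]
    · ring
    · rintro ⟨i, j, k⟩ ⟨i', j', k'⟩ h
      simpa using h
  · rw [hcard _ nM, Finset.card_image_of_injective]
    · simp [ZMod.card]
    · exact fun d d' h => Label.M.inj h
  · rw [hcard _ nL, Finset.card_singleton]
  · rw [hcard _ nG, Finset.card_image_of_injective, hZ]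
    exact fun d d' h => Label.G.inj h
  all_goals
    simp only [Finset.forall_mem_image, mS, mM, mL, mG, card_orbitOf, total_chi_orbitOf,
      total_chiHat_orbitOf]
  · rintro _ ⟨i, j, k, hi, hj, hk, rfl⟩
    exact card_fiber_S hi hj hk
  · rintro _ ⟨d, hd, rfl⟩
    exact card_fiber_M hd
  · rintro _ rfl
    exact card_fiber_G_zero
  · rintro _ ⟨m, hm, rfl⟩
    exact card_fiber_G hm
  · rintro _ ⟨i, j, k, hi, hj, hk, rfl⟩
    exact sum_antichainCard_S hi hj hk
  · rintro _ ⟨d, hd, rfl⟩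
    exact sum_antichainCard_M hd
  · rintro _ rfl
    exact sum_antichainCard_G_zero
  · rintro _ ⟨m, hm, rfl⟩
    exact sum_antichainCard_G hm
  · rintro _ ⟨i, j, k, hi, hj, hk, rfl⟩
    exact sum_idealCard_S hi hj hk
  · rintro _ ⟨d, hd, rfl⟩
    exact sum_idealCard_M hd
  · rintro _ rfl
    exact sum_idealCard_G_zero
  · rintro _ ⟨m, hm, rfl⟩
    exact sum_idealCard_G hm

end FenceRowmotion

theorem mainTheorem6 (a : ℕ) (ha : 2 ≤ a) :
    (∃ S M L G : Finset (Finset (Antichains (Fence [a, a, a, a]))),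
      -- the orbits of rowmotion on antichains are partitioned into the four sets
      ((∀ O, O ∈ orbits (rowmotion (Fence [a, a, a, a])) ↔ O ∈ S ∨ O ∈ M ∨ O ∈ L ∨ O ∈ G) ∧
        Disjoint S M ∧ Disjoint S L ∧ Disjoint S G ∧
        Disjoint M L ∧ Disjoint M G ∧ Disjoint L G) ∧
      -- numbers of orbits
      (S.card = (a - 1) ^ 3 ∧ M.card = a ∧ L.card = 1 ∧ G.card = a - 1) ∧
      -- sizes of orbits
      ((∀ O ∈ S, O.card = a) ∧
        (∀ O ∈ M, O.card = a + 1) ∧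
        (∀ O ∈ L, O.card = a ^ 2 + a + 1) ∧
        (∀ O ∈ G, O.card = 3 * a ^ 2 + a)) ∧
      -- values of the antichain cardinality
      ((∀ O ∈ S, (total chi O : ℤ) = 4 * a - 4) ∧
        (∀ O ∈ M, (total chi O : ℤ) = 4 * a - 2) ∧
        (∀ O ∈ L, (total chi O : ℤ) = 4 * a ^ 2 - a) ∧
        (∀ O ∈ G, (total chi O : ℤ) = 12 * a ^ 2 - 11 * a + 2)) ∧
      -- values of the ideal cardinality on the corresponding orbits of ideals
      ((∀ O ∈ S, (total chiHat (idealsOf O) : ℤ) = 2 * a ^ 2 - a) ∧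
        (∀ O ∈ M, (total chiHat (idealsOf O) : ℤ) = 2 * a ^ 2 + 3 * a - 1) ∧
        (∀ O ∈ L, (total chiHat (idealsOf O) : ℤ) = 2 * a ^ 3 + 3 * a - 1) ∧
        (∀ O ∈ G, (total chiHat (idealsOf O) : ℤ) = 6 * a ^ 3 - a))) ∧
    -- the orbits of rowmotion on ideals are exactly those that correspond to orbits on antichains
    (∀ Q, Q ∈ orbits (rowmotionIdeal (Fence [a, a, a, a])) ↔
      ∃ O ∈ orbits (rowmotion (Fence [a, a, a, a])), idealsOf O = Q) ∧
    IsOrbomesic (rowmotion (Fence [a, a, a, a])) chi ∧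
    IsOrbomesic (rowmotionIdeal (Fence [a, a, a, a])) chiHat := by
  have hideal : ∀ Q, Q ∈ orbits (rowmotionIdeal (Fence [a, a, a, a])) ↔
      ∃ O ∈ orbits (rowmotion (Fence [a, a, a, a])), idealsOf O = Q :=
    mem_orbits_conj (maximals _).symm maximals_symm_rowmotion
  obtain ⟨S, M, L, G, h1, h2, h3, h4, h5⟩ := exists_orbit_classes a ha
  -- The four orbit sizes are distinct, so that the size of an orbit determines its class.
  have d1 : a ^ 2 + a + 1 ≠ a := by omega
  have d2 : a ^ 2 + a + 1 ≠ a + 1 := by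
    have := pow_pos (show 0 < a by omega) 2
    omega
  have d3 : 3 * a ^ 2 + a ≠ a := by
    have := pow_pos (show 0 < a by omega) 2
    omega
  have d4 : 3 * a ^ 2 + a ≠ a + 1 := by omega
  have d5 : 3 * a ^ 2 + a ≠ a ^ 2 + a + 1 := by omega
  refine ⟨⟨S, M, L, G, h1, h2, h3, h4, h5⟩, hideal, ?_, ?_⟩
  · refine isOrbomesic_of_total_eq (fun n => if n = a then 4 * a - 4 else if n = a + 1 then 4 * a - 2
      else if n = a ^ 2 + a + 1 then 4 * a ^ 2 - a else 12 * a ^ 2 - 11 * a + 2) fun O hO => ?_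
    rcases (h1.1 O).1 hO with h | h | h | h
    · simp [h3.1 O h, h4.1 O h]
    · simp [h3.2.1 O h, h4.2.1 O h]
    · simp only [h3.2.2.1 O h, h4.2.2.1 O h, if_neg d1, if_neg d2, if_true]
    · simp only [h3.2.2.2 O h, h4.2.2.2 O h, if_neg d3, if_neg d4, if_neg d5]
  · refine isOrbomesic_of_total_eq (fun n => if n = a then 2 * a ^ 2 - a
      else if n = a + 1 then 2 * a ^ 2 + 3 * a - 1
      else if n = a ^ 2 + a + 1 then 2 * a ^ 3 + 3 * a - 1 else 6 * a ^ 3 - a) fun Q hQ => ?_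
    obtain ⟨O, hO, rfl⟩ := (hideal Q).1 hQ
    have hc : (idealsOf O).card = O.card := Finset.card_map _
    rw [hc]
    rcases (h1.1 O).1 hO with h | h | h | h
    · simp [h3.1 O h, h5.1 O h]
    · simp [h3.2.1 O h, h5.2.1 O h]
    · simp only [h3.2.2.1 O h, h5.2.2.1 O h, if_neg d1, if_neg d2, if_true]
    · simp only [h3.2.2.2 O h, h5.2.2.2 O h, if_neg d3, if_neg d4, if_neg d5]
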